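/- Let $\mathscr G$ be an ample groupoid: a topological groupoid whose unit space $\mathscr G^{(0)}$ is locally compact Hausdorff with a basis of compact open sets and whose range map $r$ is a local homeomorphism; write $d$ for the source map. A bisection is a set of arrows on which $d$ and $r$ are injective. Let $\mathcal O=(E,p,\alpha)$ be a $\mathscr G$-sheaf of unital rings: $p\colon E\to\mathscr G^{(0)}$ is a local homeomorphism, each stalk $\mathcal O_x=p^{-1}(x)$ is a unital ring, fibrewise addition and multiplication and the unit section are continuous, and $\mathscr G$ acts continuously on $E$ by ring homomorphisms $\alpha_\gamma\colon\mathcal O_{d(\gamma)}\to\mathcal O_{r(\gamma)}$ with $\alpha_{1_x}=\mathrm{id}$ and $\alpha_\beta\alpha_\gamma=\alpha_{\beta\gamma}$. Let $\Gamma_c(\mathscr G,\mathcal O)$ be the (not necessarily unital) ring whose additive group is generated by the maps $f\colon\mathscr G\to E$ with $p\circ f=r$ for which there is a compact open bisection $U$ such that $f|_U$ is continuous and $f$ is zero off $U$, with pointwise addition and convolution $(f*g)(\gamma)=\sum_{\beta\rho=\gamma}f(\beta)\,\alpha_\beta(g(\rho))$. For a unit $x$ let $\mathscr G_x^x$ be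 its isotropy group and $B_x=\mathcal O_x\rtimes\mathscr G_x^x$ the isotropy skew group ring, so that $(a\delta)(b\eta)=a\,\alpha_\delta(b)\,\delta\eta$. Let $\mathcal L_x=\bigoplus_{d(\gamma)=x}\mathcal O_{r(\gamma)}$, with elements written as sums of terms $a1_\gamma$ ($a\in\mathcal O_{r(\gamma)}$); it is a $\Gamma_c(\mathscr G,\mathcal O)$-$B_x$-bimodule via $$f\cdot a1_\gamma=\sum_{d(\beta)=r(\gamma)}f(\beta)\,\alpha_\beta(a)\,1_{\beta\gamma},\qquad a1_\gamma\cdot b\delta=a\,\alpha_\gamma(b)\,1_{\gamma\delta}.$$ For a left $B_x$-module $M$ put $\mathrm{Ind}_x(M)=\mathcal L_x\otimes_{B_x}M$, a left $\Gamma_c(\mathscr G,\mathcal O)$-module. A ring $S$ is a left max ring if every nonzero left $S$-module has a maximal proper submodule. A (left) primitive ideal is the annihilator of a simple left module, where a simple module over the possibly non-unital ring $R=\Gamma_c(\mathscr G,\mathcal O)$ is a nonzero module $N$ with $RN=N$ whose only submodules are $0$ and $N$. **Theorem (Effros–Hahn for groupoid algebras with sheaf coefficients).** Suppose that $B_x$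 is a left max ring for every $x\in\mathscr G^{(0)}$. Then the primitive ideals of $\Gamma_c(\mathscr G,\mathcal O)$ are exactly the ideals of the form $\mathrm{Ann}(\mathrm{Ind}_x(M))$, where $x\in\mathscr G^{(0)}$ and $M$ is a simple left $B_x$-module. -/

import Mathlib

open CategoryTheory
open scoped TensorProduct

universe u w v

noncomputable section

/-! ### Ample groupoids

A groupoid is a Mathlib `Groupoid` on the type `X` of units; `Quiver.Total X` is its arrow space.
An arrow `γ : x ⟶ y` has source `d(γ) = x` and range `r(γ) = y`.  The product `βγ`, defined when
`d(β) = r(γ)`, is `γ ≫ β`. -/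

/-- Pairs of arrows `fst : x ⟶ y`, `snd : y ⟶ z`, i.e. the domain of the multiplication. -/
structure ComposablePair (X : Type u) [Groupoid.{w} X] where
  (x y z : X)
  fst : x ⟶ y
  snd : y ⟶ z

/-- The subspace topology inherited from the product of two copies of the arrow space. -/
instance (X : Type u) [Groupoid.{w} X] [TopologicalSpace (Quiver.Total X)] :
    TopologicalSpace (ComposablePair X) :=
  TopologicalSpace.induced
    (fun c => ((⟨c.x, c.y, c.fst⟩, ⟨c.y, c.z, c.snd⟩) : Quiver.Total X × Quiver.Total X))
    inferInstance

/-- A topological groupoid: the structure maps are continuous.  Continuity of the unit map and of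
the source map make `X` homeomorphic to the subspace of units of the arrow space. -/
class IsTopologicalGroupoid (X : Type u) [Groupoid.{w} X] [TopologicalSpace X]
    [TopologicalSpace (Quiver.Total X)] : Prop where
  continuous_source : Continuous (fun γ : Quiver.Total X => γ.left)
  continuous_range : Continuous (fun γ : Quiver.Total X => γ.right)
  continuous_unit : Continuous (fun x : X => (⟨x, x, 𝟙 x⟩ : Quiver.Total X))
  continuous_inv :
    Continuous (fun γ : Quiver.Total X => (⟨γ.right, γ.left, Groupoid.inv γ.hom⟩ : Quiver.Total X))
  continuous_mul :
    Continuous (fun c : ComposablePair X => (⟨c.x, c.z, c.fst ≫ c.snd⟩ : Quiver.Total X))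

/-- An étale groupoid: the unit space is locally compact Hausdorff and the range map is a local
homeomorphism. -/
class IsEtaleGroupoid (X : Type u) [Groupoid.{w} X] [TopologicalSpace X]
    [TopologicalSpace (Quiver.Total X)] : Prop extends IsTopologicalGroupoid X where
  t2Space : T2Space X
  locallyCompactSpace : LocallyCompactSpace X
  isLocalHomeomorph_range : IsLocalHomeomorph (fun γ : Quiver.Total X => γ.right)

/-- An ample groupoid: an étale groupoid whose unit space has a basis of compact open sets. -/
class IsAmpleGroupoid (X : Type u) [Groupoid.{w} X] [TopologicalSpace X]
    [TopologicalSpace (Quiver.Total X)] : Prop extends IsEtaleGroupoid X where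
  isTopologicalBasis_compactOpen :
    TopologicalSpace.IsTopologicalBasis {U : Set X | IsOpen U ∧ IsCompact U}

/-- Compact open bisections.  (In an étale groupoid such a set is homeomorphic to its image under
the range map, hence automatically Hausdorff.) -/
structure IsCompactOpenBisection {X : Type u} [Groupoid.{w} X] [TopologicalSpace (Quiver.Total X)]
    (U : Set (Quiver.Total X)) : Prop where
  isOpen : IsOpen U
  isCompact : IsCompact U
  injOn_source : Set.InjOn (fun γ : Quiver.Total X => γ.left) U
  injOn_range : Set.InjOn (fun γ : Quiver.Total X => γ.right) U

/-! ### Sheaves of rings -/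

/-- The total space `E` of a family of stalks; the projection `p` is `EtaleSpace.base`. -/
structure EtaleSpace {X : Type u} (S : X → Type v) where
  base : X
  val : S base

/-- The pullback `E ×_{p,p} E`. -/
structure FiberPair {X : Type u} (S : X → Type v) where
  base : X
  fst : S base
  snd : S base

instance {X : Type u} (S : X → Type v) [TopologicalSpace (EtaleSpace S)] :
    TopologicalSpace (FiberPair S) :=
  TopologicalSpace.induced
    (fun e => ((⟨e.base, e.fst⟩, ⟨e.base, e.snd⟩) : EtaleSpace S × EtaleSpace S)) inferInstance

/-- The pullback of the source map and the projection `p`: pairs of an arrow `γ` and a point of the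
stalk at `d(γ)`. -/
structure ActionPair {X : Type u} [Groupoid.{w} X] (S : X → Type v) where
  (x y : X)
  hom : x ⟶ y
  val : S x

instance {X : Type u} [Groupoid.{w} X] (S : X → Type v) [TopologicalSpace (Quiver.Total X)]
    [TopologicalSpace (EtaleSpace S)] : TopologicalSpace (ActionPair S) :=
  TopologicalSpace.induced
    (fun e => ((⟨e.x, e.y, e.hom⟩, ⟨e.x, e.val⟩) : Quiver.Total X × EtaleSpace S)) inferInstance

/-- A `𝒢`-sheaf of (unital) rings on the groupoid with unit space `X`. -/
structure GroupoidRingSheaf (X : Type u) [Groupoid.{w} X] [TopologicalSpace X]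
    [TopologicalSpace (Quiver.Total X)] where
  /-- the stalks `𝒪_x` -/
  stalk : X → Type v
  [ring : ∀ x, Ring (stalk x)]
  /-- the topology of the total space -/
  [topology : TopologicalSpace (EtaleSpace stalk)]
  isLocalHomeomorph_base : IsLocalHomeomorph (EtaleSpace.base : EtaleSpace stalk → X)
  /-- the action `α_γ : 𝒪_{d(γ)} → 𝒪_{r(γ)}` by ring homomorphisms -/
  act : ∀ {x y : X}, (x ⟶ y) → (stalk x →+* stalk y)
  act_unit : ∀ (x : X) (a : stalk x), act (𝟙 x) a = a
  act_mul : ∀ {x y z : X} (γ : x ⟶ y) (β : y ⟶ z) (a : stalk x),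
    act β (act γ a) = act (γ ≫ β) a
  continuous_act : Continuous
    (fun e : ActionPair stalk => (⟨e.y, act e.hom e.val⟩ : EtaleSpace stalk))
  continuous_add : Continuous
    (fun e : FiberPair stalk => (⟨e.base, e.fst + e.snd⟩ : EtaleSpace stalk))
  continuous_mul : Continuous
    (fun e : FiberPair stalk => (⟨e.base, e.fst * e.snd⟩ : EtaleSpace stalk))
  continuous_one : Continuous (fun x : X => (⟨x, 1⟩ : EtaleSpace stalk))

attribute [instance] GroupoidRingSheaf.ring GroupoidRingSheaf.topology

namespace GroupoidRingSheaf

variable {X : Type u} [Groupoid.{w} X] [TopologicalSpace X] [TopologicalSpace (Quiver.Total X)]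
  (O : GroupoidRingSheaf.{u, w, v} X)

/-! ### The convolution algebra -/

/-- The additive group of all maps `f` with `f γ ∈ 𝒪_{r(γ)}`. -/
abbrev ArrowSection : Type (max u w v) := ∀ γ : Quiver.Total X, O.stalk γ.right

/-- `f` is supported on `U`: it is continuous on `U` and vanishes off `U`. -/
def SupportedOn (f : O.ArrowSection) (U : Set (Quiver.Total X)) : Prop :=
  ContinuousOn (fun γ => (⟨γ.right, f γ⟩ : EtaleSpace O.stalk)) U ∧ ∀ γ, γ ∉ U → f γ = 0

/-- The additive group `Γ_c(𝒢, 𝒪)`, generated by the maps supported on compact open bisections. -/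
def convAddSubgroup : AddSubgroup O.ArrowSection :=
  AddSubgroup.closure {f | ∃ U, IsCompactOpenBisection U ∧ O.SupportedOn f U}

/-- Convolution: `(f * g)(γ)` is the sum of `f(β) α_β(g(ρ))` over all factorizations `γ = βρ`.
A factorization is determined by `β`, an arbitrary arrow with range `r(γ)`, as `ρ = β⁻¹γ`. -/
def conv (f g : O.ArrowSection) : O.ArrowSection := fun γ =>
  ∑ᶠ β : Quiver.Costar γ.right,
    f ⟨β.1, γ.right, β.2⟩ * O.act β.2 (g ⟨γ.left, β.1, γ.hom ≫ Groupoid.inv β.2⟩)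

variable {O}

/-- `f` is nonzero at only finitely many points of each fibre of the range and source maps. -/
def FiberFinite (f : O.ArrowSection) : Prop :=
  (∀ y, {β : Quiver.Costar y | f ⟨β.1, y, β.2⟩ ≠ 0}.Finite) ∧
    ∀ x, {β : Quiver.Star x | f ⟨x, β.1, β.2⟩ ≠ 0}.Finite

theorem SupportedOn.fiberFinite {f : O.ArrowSection} {U : Set (Quiver.Total X)}
    (hU : IsCompactOpenBisection U) (hf : O.SupportedOn f U) : FiberFinite f := by
  constructor
  · intro y
    refine Set.Subsingleton.finite ?_
    rintro ⟨a, ha⟩ h1 ⟨b, hb⟩ h2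
    have m1 : (⟨a, y, ha⟩ : Quiver.Total X) ∈ U := by
      by_contra h; exact h1 (hf.2 _ h)
    have m2 : (⟨b, y, hb⟩ : Quiver.Total X) ∈ U := by
      by_contra h; exact h2 (hf.2 _ h)
    have := hU.injOn_range m1 m2 rfl
    cases this
    rfl
  · intro x
    refine Set.Subsingleton.finite ?_
    rintro ⟨a, ha⟩ h1 ⟨b, hb⟩ h2
    have m1 : (⟨x, a, ha⟩ : Quiver.Total X) ∈ U := by
      by_contra h; exact h1 (hf.2 _ h)
    have m2 : (⟨x, b, hb⟩ : Quiver.Total X) ∈ U := by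
      by_contra h; exact h2 (hf.2 _ h)
    have := hU.injOn_source m1 m2 rfl
    cases this
    rfl

theorem fiberFinite_of_mem {f : O.ArrowSection} (hf : f ∈ O.convAddSubgroup) : FiberFinite f := by
  induction hf using AddSubgroup.closure_induction with
  | mem f h => obtain ⟨U, hU, h⟩ := h; exact h.fiberFinite hU
  | zero => constructor <;> intro y <;> simp
  | add f g _ _ hf hg =>
    constructor <;> intro y
    · refine ((hf.1 y).union (hg.1 y)).subset fun β h => ?_
      by_contra hc
      simp only [Set.mem_union, Set.mem_ofPred_eq, not_or, not_not] at hc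
      exact h (by simp [hc.1, hc.2])
    · refine ((hf.2 y).union (hg.2 y)).subset fun β h => ?_
      by_contra hc
      simp only [Set.mem_union, Set.mem_ofPred_eq, not_or, not_not] at hc
      exact h (by simp [hc.1, hc.2])
  | neg f _ hf =>
    constructor <;> intro y
    · simpa using hf.1 y
    · simpa using hf.2 y

/-- The convolution of `f` with a section over the fibre of the source map at `x`. -/
def fiberConv (f : O.ArrowSection) {x : X} (h : ∀ γ : Quiver.Star x, O.stalk γ.1) :
    ∀ γ : Quiver.Star x, O.stalk γ.1 := fun γ =>
  ∑ᶠ β : Quiver.Costar γ.1,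
    f ⟨β.1, γ.1, β.2⟩ * O.act β.2 (h ⟨β.1, γ.2 ≫ Groupoid.inv β.2⟩)

theorem fiberConv_finite {f : O.ArrowSection} (hf : FiberFinite f) {x : X}
    (h : ∀ γ : Quiver.Star x, O.stalk γ.1) (γ : Quiver.Star x) :
    {β : Quiver.Costar γ.1 | (f ⟨β.1, γ.1, β.2⟩ *
      O.act β.2 (h ⟨β.1, γ.2 ≫ Groupoid.inv β.2⟩) : O.stalk γ.1) ≠ 0}.Finite := by
  refine (hf.1 γ.1).subset fun β hβ h0 => hβ ?_
  simp only at h0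
  rw [h0, zero_mul]

theorem fiberConv_add_right {f : O.ArrowSection} (hf : FiberFinite f) {x : X}
    (h k : ∀ γ : Quiver.Star x, O.stalk γ.1) :
    fiberConv f (h + k) = fiberConv f h + fiberConv f k := by
  funext γ
  simp only [fiberConv, Pi.add_apply, map_add, mul_add]
  exact finsum_add_distrib (fiberConv_finite hf h γ) (fiberConv_finite hf k γ)

theorem fiberConv_add_left {f g : O.ArrowSection} (hf : FiberFinite f) (hg : FiberFinite g) {x : X}
    (h : ∀ γ : Quiver.Star x, O.stalk γ.1) :
    fiberConv (f + g) h = fiberConv f h + fiberConv g h := by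
  funext γ
  simp only [fiberConv, Pi.add_apply, add_mul]
  exact finsum_add_distrib (fiberConv_finite hf h γ) (fiberConv_finite hg h γ)

/-- For an arrow `δ` with range `y`, left multiplication by `δ` on arrows. -/
def costarEquiv {a y : X} (δ : a ⟶ y) : Quiver.Costar a ≃ Quiver.Costar y where
  toFun ε := ⟨ε.1, ε.2 ≫ δ⟩
  invFun β := ⟨β.1, β.2 ≫ Groupoid.inv δ⟩
  left_inv ε := by simp
  right_inv β := by simp

theorem fiberConv_assoc {f g : O.ArrowSection} (hf : FiberFinite f) (hg : FiberFinite g) {x : X}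
    (h : ∀ γ : Quiver.Star x, O.stalk γ.1) :
    fiberConv (O.conv f g) h = fiberConv f (fiberConv g h) := by
  funext γ
  obtain ⟨y, γ⟩ := γ
  have hS := hf.1 y
  -- the common double sum
  let F : Quiver.Costar y → Quiver.Costar y → O.stalk y := fun δ β =>
    f ⟨δ.1, y, δ.2⟩ * O.act δ.2 (g ⟨β.1, δ.1, β.2 ≫ Groupoid.inv δ.2⟩) *
      O.act β.2 (h ⟨β.1, γ ≫ Groupoid.inv β.2⟩)
  have hF : ∀ δ, (Function.support (F δ)).Finite := by
    intro δ
    refine ((hg.1 δ.1).image (costarEquiv δ.2)).subset fun β hβ => ?_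
    refine ⟨(costarEquiv δ.2).symm β, ?_, by simp⟩
    intro h0
    refine hβ ?_
    have h0' : g ⟨β.1, δ.1, β.2 ≫ Groupoid.inv δ.2⟩ = 0 := h0
    simp [F, h0']
  have hF0 : ∀ δ, δ ∉ hS.toFinset → F δ = 0 := by
    intro δ hδ
    have : f ⟨δ.1, y, δ.2⟩ = 0 := by simpa using hδ
    funext β
    simp [F, this]
  have hL : fiberConv (O.conv f g) h ⟨y, γ⟩ = ∑ᶠ β, ∑ δ ∈ hS.toFinset, F δ β := by
    refine finsum_congr fun β => ?_
    have : O.conv f g ⟨β.1, y, β.2⟩ = ∑ δ ∈ hS.toFinset,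
        f ⟨δ.1, y, δ.2⟩ * O.act δ.2 (g ⟨β.1, δ.1, β.2 ≫ Groupoid.inv δ.2⟩) := by
      refine finsum_eq_sum_of_support_subset _ fun δ hδ => ?_
      simp only [Set.Finite.coe_toFinset, Set.mem_ofPred_eq]
      intro h0
      exact hδ (by simp only; rw [h0, zero_mul])
    simp only [this, Finset.sum_mul, F]
  have hR : fiberConv f (fiberConv g h) ⟨y, γ⟩ = ∑ δ ∈ hS.toFinset, ∑ᶠ β, F δ β := by
    have h1 : fiberConv f (fiberConv g h) ⟨y, γ⟩ = ∑ᶠ δ, ∑ᶠ β, F δ β := by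
      refine finsum_congr fun δ => ?_
      rw [← finsum_comp_equiv (costarEquiv δ.2)]
      have := fiberConv_finite hg h ⟨δ.1, γ ≫ Groupoid.inv δ.2⟩
      simp only at this
      have e1 := ((AddMonoidHom.mulLeft (f ⟨δ.1, y, δ.2⟩)).comp
        (O.act δ.2).toAddMonoidHom).map_finsum this
      refine Eq.trans ?_ (e1.trans (finsum_congr fun ε => ?_))
      · rfl
      · simp only [F, costarEquiv, Equiv.coe_fn_mk, AddMonoidHom.comp_apply,
          AddMonoidHom.coe_mulLeft, RingHom.toAddMonoidHom_eq_coe, AddMonoidHom.coe_coe, map_mul,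
          O.act_mul]
        have a1 : (ε.2 ≫ δ.2) ≫ Groupoid.inv δ.2 = ε.2 := by simp
        have a2 : γ ≫ Groupoid.inv (ε.2 ≫ δ.2) = (γ ≫ Groupoid.inv δ.2) ≫ Groupoid.inv ε.2 := by
          simp
        rw [a1, a2, mul_assoc]
    rw [h1]
    refine finsum_eq_sum_of_support_subset _ fun δ hδ => ?_
    by_contra hc
    refine hδ ?_
    have hc' : δ ∉ hS.toFinset := fun h => hc h
    simp [hF0 δ hc']
  rw [hL, hR]
  exact (finsum_sum_comm _ _ fun δ _ => hF δ)

theorem conv_apply (f g : O.ArrowSection) (γ : Quiver.Total X) :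
    O.conv f g γ = fiberConv f (fun β : Quiver.Star γ.left => g ⟨γ.left, β.1, β.2⟩)
      ⟨γ.right, γ.hom⟩ := rfl

/-! Convolution preserves `Γ_c(𝒢, 𝒪)`. -/

/-- The product `UV` of two sets of arrows. -/
def arrowMul (U V : Set (Quiver.Total X)) : Set (Quiver.Total X) :=
  {γ | ∃ β : Quiver.Costar γ.right, (⟨β.1, γ.right, β.2⟩ : Quiver.Total X) ∈ U ∧
    (⟨γ.left, β.1, γ.hom ≫ Groupoid.inv β.2⟩ : Quiver.Total X) ∈ V}

set_option linter.unusedSectionVars false in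
theorem costar_eq {U : Set (Quiver.Total X)} (hU : IsCompactOpenBisection U) {y : X}
    {β β' : Quiver.Costar y} (h : (⟨β.1, y, β.2⟩ : Quiver.Total X) ∈ U)
    (h' : (⟨β'.1, y, β'.2⟩ : Quiver.Total X) ∈ U) : β = β' := by
  obtain ⟨a, ha⟩ := β
  obtain ⟨b, hb⟩ := β'
  have := hU.injOn_range h h' rfl
  cases this
  rfl

theorem conv_eq_single {f g : O.ArrowSection} {U : Set (Quiver.Total X)}
    (hU : IsCompactOpenBisection U) (hf : O.SupportedOn f U)
    (γ : Quiver.Total X) (β : Quiver.Costar γ.right)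
    (hβ : (⟨β.1, γ.right, β.2⟩ : Quiver.Total X) ∈ U) :
    O.conv f g γ = f ⟨β.1, γ.right, β.2⟩ *
      O.act β.2 (g ⟨γ.left, β.1, γ.hom ≫ Groupoid.inv β.2⟩) := by
  refine finsum_eq_single _ β fun β' hne => ?_
  have : (⟨β'.1, γ.right, β'.2⟩ : Quiver.Total X) ∉ U := fun h => hne (costar_eq hU h hβ)
  have := hf.2 _ this
  simp only at this ⊢
  rw [this, zero_mul]

theorem conv_add {f g h : O.ArrowSection} (hf : FiberFinite f) :
    O.conv f (g + h) = O.conv f g + O.conv f h := by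
  funext γ
  exact congrFun (fiberConv_add_right hf (fun β : Quiver.Star γ.left => g ⟨γ.left, β.1, β.2⟩)
    (fun β : Quiver.Star γ.left => h ⟨γ.left, β.1, β.2⟩)) ⟨γ.right, γ.hom⟩

theorem add_conv {f g h : O.ArrowSection} (hf : FiberFinite f) (hg : FiberFinite g) :
    O.conv (f + g) h = O.conv f h + O.conv g h := by
  funext γ
  exact congrFun (fiberConv_add_left hf hg
    (fun β : Quiver.Star γ.left => h ⟨γ.left, β.1, β.2⟩)) ⟨γ.right, γ.hom⟩

theorem conv_zero (f : O.ArrowSection) : O.conv f 0 = 0 := by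
  funext γ
  simp [conv]

theorem zero_conv (f : O.ArrowSection) : O.conv 0 f = 0 := by
  funext γ
  simp [conv]

theorem conv_neg (f g : O.ArrowSection) : O.conv f (-g) = -O.conv f g := by
  funext γ
  simp [conv, finsum_neg_distrib]

theorem neg_conv (f g : O.ArrowSection) : O.conv (-f) g = -O.conv f g := by
  funext γ
  simp [conv, finsum_neg_distrib]

theorem conv_assoc {f g h : O.ArrowSection} (hf : FiberFinite f) (hg : FiberFinite g) :
    O.conv (O.conv f g) h = O.conv f (O.conv g h) := by
  funext γ
  exact congrFun (fiberConv_assoc hf hg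
    (fun β : Quiver.Star γ.left => h ⟨γ.left, β.1, β.2⟩)) ⟨γ.right, γ.hom⟩

/-- The arrow of `U` with the same range as a given arrow. -/
def liftCostar {U : Set (Quiver.Total X)} (γ : (fun γ : Quiver.Total X => γ.right) ⁻¹'
    ((fun γ : Quiver.Total X => γ.right) '' U)) :
    {β : Quiver.Costar γ.1.right // (⟨β.1, γ.1.right, β.2⟩ : Quiver.Total X) ∈ U} :=
  Classical.choice <| by
    obtain ⟨γ, ⟨a, b, β⟩, hβ, h⟩ := γ
    dsimp only at h
    subst h
    exact ⟨⟨⟨a, β⟩, hβ⟩⟩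

section Ample

variable [IsAmpleGroupoid X]

theorem continuous_liftCostar {U : Set (Quiver.Total X)} (hU : IsCompactOpenBisection U) :
    Continuous (fun γ : (fun γ : Quiver.Total X => γ.right) ⁻¹'
      ((fun γ : Quiver.Total X => γ.right) '' U) =>
        (⟨⟨(liftCostar γ).1.1, γ.1.right, (liftCostar γ).1.2⟩, (liftCostar γ).2⟩ : U)) := by
  have hr := IsEtaleGroupoid.isLocalHomeomorph_range (X := X)
  have he : Topology.IsOpenEmbedding (fun γ : U => γ.1.right) :=
    .of_continuous_injective_isOpenMap (hr.continuous.comp continuous_subtype_val)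
      (fun a b h => Subtype.ext (hU.injOn_range a.2 b.2 h))
      (hr.isOpenMap.comp hU.isOpen.isOpenMap_subtype_val)
  rw [he.isInducing.continuous_iff]
  change Continuous (fun γ : (fun γ : Quiver.Total X => γ.right) ⁻¹'
    ((fun γ : Quiver.Total X => γ.right) '' U) => γ.1.right)
  exact hr.continuous.comp continuous_subtype_val

theorem continuous_quotient {U : Set (Quiver.Total X)} (hU : IsCompactOpenBisection U) :
    Continuous (fun γ : (fun γ : Quiver.Total X => γ.right) ⁻¹'
      ((fun γ : Quiver.Total X => γ.right) '' U) =>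
        (⟨γ.1.left, (liftCostar γ).1.1, γ.1.hom ≫ Groupoid.inv (liftCostar γ).1.2⟩ :
          Quiver.Total X)) := by
  have h1 : Continuous (fun γ : (fun γ : Quiver.Total X => γ.right) ⁻¹'
      ((fun γ : Quiver.Total X => γ.right) '' U) =>
      (⟨γ.1.left, γ.1.right, (liftCostar γ).1.1, γ.1.hom, Groupoid.inv (liftCostar γ).1.2⟩ :
        ComposablePair X)) := by
    rw [continuous_induced_rng]
    exact continuous_subtype_val.prodMk (IsTopologicalGroupoid.continuous_inv.comp
      (continuous_subtype_val.comp (continuous_liftCostar hU)))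
  exact IsTopologicalGroupoid.continuous_mul.comp h1

theorem IsCompactOpenBisection.arrowMul {U V : Set (Quiver.Total X)}
    (hU : IsCompactOpenBisection U) (hV : IsCompactOpenBisection V) :
    IsCompactOpenBisection (arrowMul U V) where
  isOpen := by
    have hr := IsEtaleGroupoid.isLocalHomeomorph_range (X := X)
    have hW : IsOpen ((fun γ : Quiver.Total X => γ.right) ⁻¹'
      ((fun γ : Quiver.Total X => γ.right) '' U)) :=
      (hr.isOpenMap _ hU.isOpen).preimage hr.continuous
    have := hW.isOpenMap_subtype_val _ (hV.isOpen.preimage (continuous_quotient hU))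
    convert this using 1
    ext γ
    constructor
    · rintro ⟨β, h1, h2⟩
      refine ⟨⟨γ, ⟨_, h1, rfl⟩⟩, ?_, rfl⟩
      have : β = (liftCostar (U := U) ⟨γ, ⟨_, h1, rfl⟩⟩).1 :=
        costar_eq hU h1 (liftCostar (U := U) ⟨γ, ⟨_, h1, rfl⟩⟩).2
      rw [this] at h2
      exact h2
    · rintro ⟨γ, h, rfl⟩
      exact ⟨(liftCostar γ).1, (liftCostar γ).2, h⟩
  isCompact := by
    have := IsEtaleGroupoid.t2Space (X := X)
    let j : ComposablePair X → Quiver.Total X × Quiver.Total X :=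
      fun c => (⟨c.x, c.y, c.fst⟩, ⟨c.y, c.z, c.snd⟩)
    have hj : Topology.IsInducing j := ⟨rfl⟩
    have hc : IsClosed (Set.range j) := by
      have : Set.range j = {p | p.1.right = p.2.left} := by
        ext ⟨⟨a, b, f⟩, ⟨b', c, g⟩⟩
        constructor
        · rintro ⟨d, hd⟩
          cases hd
          rfl
        · intro h
          change b = b' at h
          subst h
          exact ⟨⟨a, b, c, f, g⟩, rfl⟩
      rw [this]
      exact isClosed_eq (IsTopologicalGroupoid.continuous_range.comp continuous_fst)
        (IsTopologicalGroupoid.continuous_source.comp continuous_snd)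
    have hK := (hj.isCompact_preimage hc (hV.isCompact.prod hU.isCompact)).image
      (IsTopologicalGroupoid.continuous_mul (X := X))
    convert hK using 1
    ext γ
    constructor
    · rintro ⟨β, h1, h2⟩
      refine ⟨⟨γ.left, β.1, γ.right, γ.hom ≫ Groupoid.inv β.2, β.2⟩, ⟨h2, h1⟩, ?_⟩
      simp
    · rintro ⟨⟨x, y, z, ρ, β⟩, ⟨h2, h1⟩, rfl⟩
      refine ⟨⟨y, β⟩, h1, ?_⟩
      simpa using h2
  injOn_source := by
    rintro ⟨x, z, γ⟩ ⟨⟨y, β⟩, h1, h2⟩ ⟨x', z', γ'⟩ ⟨⟨y', β'⟩, h1', h2'⟩ h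
    dsimp only at *
    subst h
    have e := hV.injOn_source h2 h2' rfl
    simp only [Quiver.Total.mk.injEq, true_and] at e
    obtain ⟨rfl, e⟩ := e
    have e' := hU.injOn_source h1 h1' rfl
    simp only [Quiver.Total.mk.injEq, true_and] at e'
    obtain ⟨rfl, e'⟩ := e'
    rw [heq_eq_eq] at e e'
    subst e'
    have : γ = γ' := by simpa using congrArg (· ≫ β) e
    rw [this]
  injOn_range := by
    rintro ⟨x, z, γ⟩ ⟨⟨y, β⟩, h1, h2⟩ ⟨x', z', γ'⟩ ⟨⟨y', β'⟩, h1', h2'⟩ h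
    dsimp only at *
    subst h
    have e := hU.injOn_range h1 h1' rfl
    simp only [Quiver.Total.mk.injEq, true_and] at e
    obtain ⟨rfl, e⟩ := e
    have e' := hV.injOn_range h2 h2' rfl
    simp only [Quiver.Total.mk.injEq, true_and] at e'
    obtain ⟨rfl, e'⟩ := e'
    rw [heq_eq_eq] at e'
    have e := eq_of_heq e
    subst e
    have : γ = γ' := by simpa using congrArg (· ≫ β) e'
    rw [this]

theorem SupportedOn.conv {f g : O.ArrowSection} {U V : Set (Quiver.Total X)}
    (hU : IsCompactOpenBisection U) (hf : O.SupportedOn f U)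
    (hg : O.SupportedOn g V) : O.SupportedOn (O.conv f g) (arrowMul U V) := by
  constructor
  · rw [continuousOn_iff_continuous_domRestrict]
    let i : arrowMul U V → (fun γ : Quiver.Total X => γ.right) ⁻¹'
      ((fun γ : Quiver.Total X => γ.right) '' U) :=
      fun γ => ⟨γ.1, by obtain ⟨γ, β, h1, h2⟩ := γ; exact ⟨_, h1, rfl⟩⟩
    have hi : Continuous i := by fun_prop
    have hiV : ∀ γ : arrowMul U V, (⟨γ.1.left, (liftCostar (i γ)).1.1,
        γ.1.hom ≫ Groupoid.inv (liftCostar (i γ)).1.2⟩ : Quiver.Total X) ∈ V := by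
      rintro ⟨γ, β, h1, h2⟩
      have : β = (liftCostar (U := U) (i ⟨γ, β, h1, h2⟩)).1 :=
        costar_eq hU h1 (liftCostar (U := U) (i ⟨γ, β, h1, h2⟩)).2
      rw [← this]
      exact h2
    have hB := (continuous_liftCostar hU).comp hi
    have hq := (continuous_quotient hU).comp hi
    have c1 := (continuousOn_iff_continuous_domRestrict.1 hf.1).comp hB
    have c2 := (continuousOn_iff_continuous_domRestrict.1 hg.1).comp
      (hq.subtype_mk hiV)
    have c3 : Continuous (fun γ : arrowMul U V => (⟨(liftCostar (i γ)).1.1, γ.1.right,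
        (liftCostar (i γ)).1.2, g ⟨γ.1.left, (liftCostar (i γ)).1.1,
        γ.1.hom ≫ Groupoid.inv (liftCostar (i γ)).1.2⟩⟩ : ActionPair O.stalk)) := by
      rw [continuous_induced_rng]
      exact (continuous_subtype_val.comp hB).prodMk c2
    have c4 := O.continuous_act.comp c3
    have c5 : Continuous (fun γ : arrowMul U V => (⟨γ.1.right,
        f ⟨(liftCostar (i γ)).1.1, γ.1.right, (liftCostar (i γ)).1.2⟩,
        O.act (liftCostar (i γ)).1.2 (g ⟨γ.1.left, (liftCostar (i γ)).1.1,
        γ.1.hom ≫ Groupoid.inv (liftCostar (i γ)).1.2⟩)⟩ : FiberPair O.stalk)) := by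
      rw [continuous_induced_rng]
      exact c1.prodMk c4
    refine (O.continuous_mul.comp c5).congr fun γ => ?_
    simp only [Function.comp_apply, Set.domRestrict_apply]
    rw [conv_eq_single hU hf γ.1 (liftCostar (i γ)).1 (liftCostar (i γ)).2]
  · intro γ hγ
    refine finsum_eq_zero_of_forall_eq_zero fun β => ?_
    by_cases h : (⟨β.1, γ.right, β.2⟩ : Quiver.Total X) ∈ U
    · have h' := hg.2 ⟨γ.left, β.1, γ.hom ≫ Groupoid.inv β.2⟩ fun h' => hγ ⟨β, h, h'⟩
      rw [h', map_zero, mul_zero]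
    · have h' := hf.2 _ h
      simp only at h' ⊢
      rw [h', zero_mul]

theorem conv_mem {f g : O.ArrowSection} (hf : f ∈ O.convAddSubgroup)
    (hg : g ∈ O.convAddSubgroup) : O.conv f g ∈ O.convAddSubgroup := by
  induction hf using AddSubgroup.closure_induction with
  | mem f h =>
    obtain ⟨U, hU, hf⟩ := h
    induction hg using AddSubgroup.closure_induction with
    | mem g h =>
      obtain ⟨V, hV, hg⟩ := h
      exact AddSubgroup.subset_closure
        ⟨_, IsCompactOpenBisection.arrowMul hU hV, hf.conv hU hg⟩
    | zero => rw [conv_zero]; exact zero_mem _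
    | add g h _ _ hg hh => rw [conv_add (hf.fiberFinite hU)]; exact add_mem hg hh
    | neg g _ hg => rw [conv_neg]; exact neg_mem hg
  | zero => rw [zero_conv]; exact zero_mem _
  | add f f' hf hf' ihf ihf' =>
    rw [add_conv (fiberFinite_of_mem hf) (fiberFinite_of_mem hf')]; exact add_mem ihf ihf'
  | neg f _ ihf => rw [neg_conv]; exact neg_mem ihf

end Ample

variable (O) in
/-- The convolution algebra `Γ_c(𝒢, 𝒪)`. -/
def ConvAlgebra : Type (max u w v) := O.convAddSubgroup

instance : AddCommGroup O.ConvAlgebra := inferInstanceAs (AddCommGroup O.convAddSubgroup)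

/-- The ring structure of `Γ_c(𝒢, 𝒪)`: pointwise addition and convolution. -/
instance [IsAmpleGroupoid X] : NonUnitalRing O.ConvAlgebra where
  __ := (inferInstance : AddCommGroup O.ConvAlgebra)
  mul f g := ⟨O.conv f.1 g.1, conv_mem f.2 g.2⟩
  left_distrib f _ _ := Subtype.ext (conv_add (fiberFinite_of_mem f.2))
  right_distrib f g _ := Subtype.ext (add_conv (fiberFinite_of_mem f.2) (fiberFinite_of_mem g.2))
  zero_mul _ := Subtype.ext (zero_conv _)
  mul_zero _ := Subtype.ext (conv_zero _)
  mul_assoc f g _ :=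
    Subtype.ext (conv_assoc (fiberFinite_of_mem f.2) (fiberFinite_of_mem g.2))

/-! ### Isotropy skew group rings and the bimodules `L_x` -/

/-- The isotropy group `𝒢_x^x` acts on `𝒪_x`. (`End x` is the isotropy group, with the product
`δη` of arrows, i.e. `δ * η = η ≫ δ`.) -/
instance (x : X) : MulSemiringAction (End x) (O.stalk x) where
  smul δ a := O.act (X := X) (x := x) (y := x) δ a
  one_smul a := O.act_unit x a
  mul_smul δ η a := (O.act_mul (x := x) (y := x) (z := x) η δ a).symm
  smul_zero δ := map_zero (O.act (x := x) (y := x) δ)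
  smul_add δ := map_add (O.act (x := x) (y := x) δ)
  smul_one δ := map_one (O.act (x := x) (y := x) δ)
  smul_mul δ := map_mul (O.act (x := x) (y := x) δ)

theorem end_smul_def {x : X} (δ : End x) (a : O.stalk x) :
    δ • a = O.act (x := x) (y := x) δ a := rfl

variable (O) in
/-- The isotropy skew group ring `B_x = 𝒪_x ⋊ 𝒢_x^x`. -/
abbrev IsotropyRing (x : X) : Type (max w v) := SkewMonoidAlgebra (O.stalk x) (End x)

variable (O) in
/-- The direct sum `L_x` of the groups `𝒪_{r(γ)}` over all arrows `γ` with source `x`. -/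
def IndBimodule (x : X) : Type (max u w v) := Π₀ γ : Quiver.Star x, O.stalk γ.1

instance (x : X) : AddCommGroup (O.IndBimodule x) :=
  inferInstanceAs (AddCommGroup (Π₀ γ : Quiver.Star x, O.stalk γ.1))

open Classical in
/-- The element `a 1_γ` of `L_x`, additively in `a ∈ 𝒪_{r(γ)}`. -/
def indSingle {x : X} (γ : Quiver.Star x) : O.stalk γ.1 →+ O.IndBimodule x :=
  DFinsupp.singleAddHom (fun γ : Quiver.Star x => O.stalk γ.1) γ

open Classical in
/-- The universal property of the direct sum `L_x`. -/
def indLift {x : X} {A : Type*} [AddCommGroup A]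
    (φ : ∀ γ : Quiver.Star x, O.stalk γ.1 →+ A) : O.IndBimodule x →+ A :=
  DFinsupp.liftAddHom φ

@[simp]
theorem indLift_single {x : X} {A : Type*} [AddCommGroup A]
    (φ : ∀ γ : Quiver.Star x, O.stalk γ.1 →+ A) (γ : Quiver.Star x) (a : O.stalk γ.1) :
    indLift φ (indSingle γ a) = φ γ a := by
  classical
  exact DFinsupp.liftAddHom_apply_single φ γ a

theorem ind_hom_ext {x : X} {A : Type*} [AddCommGroup A] {φ ψ : O.IndBimodule x →+ A}
    (h : ∀ γ a, φ (indSingle γ a) = ψ (indSingle γ a)) : φ = ψ := by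
  classical
  exact DFinsupp.addHom_ext h

/-- Right multiplication by `b δ` on `L_x`: `a 1_γ · b δ = a α_γ(b) 1_{γδ}`. -/
def rightMonomial {x : X} (δ : End x) (b : O.stalk x) : O.IndBimodule x →+ O.IndBimodule x :=
  indLift fun γ => (indSingle (⟨γ.1, End.asHom δ ≫ γ.2⟩ : Quiver.Star x)).comp
    (AddMonoidHom.mulRight (O.act γ.2 b))

theorem rightMonomial_single {x : X} (δ : End x) (b : O.stalk x) (γ : Quiver.Star x)
    (a : O.stalk γ.1) : rightMonomial δ b (indSingle γ a) =
      indSingle (⟨γ.1, End.asHom δ ≫ γ.2⟩ : Quiver.Star x) (a * O.act γ.2 b) := by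
  rw [rightMonomial, indLift_single]
  rfl

theorem rightMonomial_add {x : X} (δ : End x) (b b' : O.stalk x) :
    rightMonomial δ (b + b') = rightMonomial δ b + rightMonomial δ b' := by
  refine ind_hom_ext fun γ a => ?_
  simp only [AddMonoidHom.add_apply, rightMonomial_single, map_add, mul_add]

theorem rightMonomial_zero {x : X} (δ : End x) :
    rightMonomial δ (0 : O.stalk x) = 0 := by
  refine ind_hom_ext fun γ a => ?_
  simp only [AddMonoidHom.zero_apply, rightMonomial_single, map_zero, mul_zero]

/-- The right action of `B_x` on `L_x`. -/
def rightMul {x : X} : O.IsotropyRing x →+ (O.IndBimodule x →+ O.IndBimodule x) where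
  toFun c := c.sum rightMonomial
  map_zero' := SkewMonoidAlgebra.sum_zero_index
  map_add' _ _ := SkewMonoidAlgebra.sum_add_index' rightMonomial_zero rightMonomial_add

theorem rightMul_single {x : X} (δ : End x) (b : O.stalk x) :
    rightMul (SkewMonoidAlgebra.single δ b) = rightMonomial δ b :=
  SkewMonoidAlgebra.sum_single_index (rightMonomial_zero δ)

theorem indSingle_congr {x y : X} {γ γ' : x ⟶ y} (h : γ = γ') (a : O.stalk y) :
    indSingle (⟨y, γ⟩ : Quiver.Star x) a = indSingle (⟨y, γ'⟩ : Quiver.Star x) a := by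
  rw [h]

theorem rightMul_one {x : X} : rightMul (1 : O.IsotropyRing x) = AddMonoidHom.id _ := by
  refine ind_hom_ext fun γ a => ?_
  rw [SkewMonoidAlgebra.one_def, rightMul_single, rightMonomial_single, map_one, mul_one]
  exact indSingle_congr (Category.id_comp γ.2) a

theorem rightMul_mul {x : X} (c d : O.IsotropyRing x) :
    rightMul (c * d) = (rightMul d).comp (rightMul c) := by
  induction c using SkewMonoidAlgebra.induction_on with
  | zero => simp
  | add c c' hc hc' => rw [add_mul, map_add, map_add, hc, hc', AddMonoidHom.comp_add]
  | single δ b =>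
    induction d using SkewMonoidAlgebra.induction_on with
    | zero => simp
    | add d d' hd hd' => rw [mul_add, map_add, map_add, hd, hd', AddMonoidHom.add_comp]
    | single η c =>
      refine ind_hom_ext fun γ a => ?_
      rw [SkewMonoidAlgebra.single_mul_single, AddMonoidHom.comp_apply]
      simp only [rightMul_single, rightMonomial_single, end_smul_def, map_mul, O.act_mul, mul_assoc]
      exact indSingle_congr (Category.assoc _ _ _) _

/-- The right `B_x`-module structure of `L_x`. -/
instance (x : X) : Module (O.IsotropyRing x)ᵐᵒᵖ (O.IndBimodule x) where
  smul c ξ := rightMul c.unop ξ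
  one_smul ξ := DFunLike.congr_fun rightMul_one ξ
  mul_smul c d ξ := DFunLike.congr_fun (rightMul_mul d.unop c.unop) ξ
  smul_zero c := map_zero (rightMul c.unop)
  smul_add c := map_add (rightMul c.unop)
  add_smul c d ξ := DFunLike.congr_fun (map_add rightMul c.unop d.unop) ξ
  zero_smul ξ := DFunLike.congr_fun (map_zero rightMul) ξ

theorem op_smul_def {x : X} (c : (O.IsotropyRing x)ᵐᵒᵖ) (ξ : O.IndBimodule x) :
    c • ξ = rightMul c.unop ξ := rfl

theorem leftSingle_finite (f : O.ConvAlgebra) {x : X} (γ : Quiver.Star x) (a : O.stalk γ.1) :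
    (Function.support fun β : Quiver.Star γ.1 =>
      indSingle (⟨β.1, γ.2 ≫ β.2⟩ : Quiver.Star x)
        (f.1 ⟨γ.1, β.1, β.2⟩ * O.act β.2 a)).Finite := by
  refine ((fiberFinite_of_mem f.2).2 γ.1).subset fun β hβ h0 => hβ ?_
  simp only at h0 ⊢
  rw [h0, zero_mul, map_zero]

/-- The product `f · a 1_γ`, which is the sum of `f(β) α_β(a) 1_{βγ}` over all arrows `β` with
`d(β) = r(γ)`. -/
def leftSingle (f : O.ConvAlgebra) {x : X} (γ : Quiver.Star x) :
    O.stalk γ.1 →+ O.IndBimodule x where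
  toFun a := ∑ᶠ β : Quiver.Star γ.1, indSingle (⟨β.1, γ.2 ≫ β.2⟩ : Quiver.Star x)
    (f.1 ⟨γ.1, β.1, β.2⟩ * O.act β.2 a)
  map_zero' := by simp
  map_add' a b := by
    simp only [map_add, mul_add]
    exact finsum_add_distrib (leftSingle_finite f γ a) (leftSingle_finite f γ b)

/-- The left action of `Γ_c(𝒢, 𝒪)` on `L_x`. -/
def leftMul (f : O.ConvAlgebra) {x : X} : O.IndBimodule x →+ O.IndBimodule x :=
  indLift (leftSingle f)

theorem leftMul_single (f : O.ConvAlgebra) {x : X} (γ : Quiver.Star x) (a : O.stalk γ.1) :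
    leftMul f (indSingle γ a) = ∑ᶠ β : Quiver.Star γ.1,
      indSingle (⟨β.1, γ.2 ≫ β.2⟩ : Quiver.Star x) (f.1 ⟨γ.1, β.1, β.2⟩ * O.act β.2 a) :=
  indLift_single _ γ a

/-- Coordinates of elements of `L_x`. -/
def indCoord {x : X} : O.IndBimodule x →+ (∀ γ : Quiver.Star x, O.stalk γ.1) :=
  DFinsupp.coeFnAddMonoidHom

theorem indCoord_injective {x : X} :
    Function.Injective (indCoord : O.IndBimodule x →+ (∀ γ : Quiver.Star x, O.stalk γ.1)) :=
  fun _ _ h => DFunLike.coe_injective (F := Π₀ γ : Quiver.Star x, O.stalk γ.1) h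

theorem indCoord_single_self {x : X} (γ : Quiver.Star x) (a : O.stalk γ.1) :
    indCoord (indSingle γ a) γ = a := by
  classical
  exact DFinsupp.single_eq_same

theorem indCoord_single_ne {x : X} {γ γ' : Quiver.Star x} (h : γ' ≠ γ) (a : O.stalk γ.1) :
    indCoord (indSingle γ a) γ' = 0 := by
  classical
  exact DFinsupp.single_eq_of_ne h

theorem indCoord_leftMul (f : O.ConvAlgebra) {x : X} (ξ : O.IndBimodule x) :
    indCoord (leftMul f ξ) = fiberConv f.1 (indCoord ξ) := by
  have hf := fiberFinite_of_mem f.2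
  let ψ : O.IndBimodule x →+ (∀ γ : Quiver.Star x, O.stalk γ.1) :=
    { toFun := fun ξ => fiberConv f.1 (indCoord ξ)
      map_zero' := by funext γ; simp [fiberConv]
      map_add' := fun ξ ξ' => by rw [map_add, fiberConv_add_right hf] }
  suffices h : indCoord.comp (leftMul f) = ψ from DFunLike.congr_fun h ξ
  refine ind_hom_ext ?_
  rintro ⟨y, γ⟩ a
  funext ⟨z, ζ⟩
  have hL : indCoord (leftMul f (indSingle ⟨y, γ⟩ a)) ⟨z, ζ⟩ =
      f.1 ⟨y, z, Groupoid.inv γ ≫ ζ⟩ * O.act (Groupoid.inv γ ≫ ζ) a := by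
    rw [leftMul_single]
    have e := ((Pi.evalAddMonoidHom (fun γ : Quiver.Star x => O.stalk γ.1) ⟨z, ζ⟩).comp
      indCoord).map_finsum (leftSingle_finite f ⟨y, γ⟩ a)
    refine e.trans ((finsum_eq_single _ ⟨z, Groupoid.inv γ ≫ ζ⟩ ?_).trans ?_)
    · rintro ⟨w, β⟩ hne
      refine indCoord_single_ne ?_ _
      intro h
      refine hne ?_
      cases h
      simp
    · have : γ ≫ Groupoid.inv γ ≫ ζ = ζ := by simp
      change indCoord (indSingle (⟨z, γ ≫ Groupoid.inv γ ≫ ζ⟩ : Quiver.Star x) _) ⟨z, ζ⟩ = _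
      rw [indSingle_congr this]
      exact indCoord_single_self (⟨z, ζ⟩ : Quiver.Star x) _
  have hR : fiberConv f.1 (indCoord (indSingle ⟨y, γ⟩ a)) ⟨z, ζ⟩ =
      f.1 ⟨y, z, Groupoid.inv γ ≫ ζ⟩ * O.act (Groupoid.inv γ ≫ ζ) a := by
    refine (finsum_eq_single _ (⟨y, Groupoid.inv γ ≫ ζ⟩ : Quiver.Costar z) ?_).trans ?_
    · rintro ⟨w, β⟩ hne
      have : (⟨w, ζ ≫ Groupoid.inv β⟩ : Quiver.Star x) ≠ ⟨y, γ⟩ := by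
        intro h
        refine hne ?_
        cases h
        simp
      simp only
      rw [indCoord_single_ne this, map_zero, mul_zero]
    · have : ζ ≫ Groupoid.inv (Groupoid.inv γ ≫ ζ) = γ := by simp
      simp only
      rw [this, indCoord_single_self]
  exact hL.trans hR.symm

theorem leftMul_add (f g : O.ConvAlgebra) {x : X} (ξ : O.IndBimodule x) :
    leftMul (f + g) ξ = leftMul f ξ + leftMul g ξ := by
  apply indCoord_injective
  rw [map_add]
  simp only [indCoord_leftMul]
  exact fiberConv_add_left (fiberFinite_of_mem f.2) (fiberFinite_of_mem g.2) _

theorem leftMul_zero {x : X} (ξ : O.IndBimodule x) : leftMul (0 : O.ConvAlgebra) ξ = 0 := by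
  have := leftMul_add (0 : O.ConvAlgebra) 0 ξ
  rw [add_zero] at this
  exact left_eq_add.1 this

theorem leftMul_mul [IsAmpleGroupoid X] (f g : O.ConvAlgebra) {x : X} (ξ : O.IndBimodule x) :
    leftMul (f * g) ξ = leftMul f (leftMul g ξ) := by
  apply indCoord_injective
  simp only [indCoord_leftMul]
  exact fiberConv_assoc (fiberFinite_of_mem f.2) (fiberFinite_of_mem g.2) _

theorem leftMul_rightMul (f : O.ConvAlgebra) {x : X} (c : O.IsotropyRing x)
    (ξ : O.IndBimodule x) : leftMul f (rightMul c ξ) = rightMul c (leftMul f ξ) := by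
  induction c using SkewMonoidAlgebra.induction_on with
  | zero => simp
  | add c c' hc hc' => simp only [map_add, AddMonoidHom.add_apply, hc, hc']
  | single δ b =>
    rw [rightMul_single]
    suffices h : (leftMul f).comp (rightMonomial δ b) = (rightMonomial δ b).comp (leftMul f) from
      DFunLike.congr_fun h ξ
    refine ind_hom_ext fun γ a => ?_
    rw [AddMonoidHom.comp_apply, AddMonoidHom.comp_apply, rightMonomial_single, leftMul_single,
      leftMul_single]
    refine Eq.trans (finsum_congr fun β => ?_)
      ((rightMonomial δ b).map_finsum (leftSingle_finite f γ a)).symm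
    rw [rightMonomial_single]
    simp only [map_mul, O.act_mul, mul_assoc]
    exact indSingle_congr (Category.assoc _ _ _) _

variable (O) in
/-- The left `Γ_c(𝒢, 𝒪)`-action on `L_x` by right `B_x`-module endomorphisms. -/
def leftAction [IsAmpleGroupoid X] (x : X) :
    O.ConvAlgebra →ₙ+* Module.End (O.IsotropyRing x)ᵐᵒᵖ (O.IndBimodule x) where
  toFun f :=
    { toFun := leftMul f
      map_add' := map_add (leftMul f)
      map_smul' := fun c ξ => leftMul_rightMul f c.unop ξ }
  map_mul' f g := LinearMap.ext (leftMul_mul f g)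
  map_zero' := LinearMap.ext leftMul_zero
  map_add' f g := LinearMap.ext (leftMul_add f g)

end GroupoidRingSheaf

/-! ### Tensor products over noncommutative rings -/

/-- The tensor product `L ⊗_S M` of a right `S`-module `L` and a left `S`-module `M`: the quotient
of the tensor product of abelian groups by the relations `l s ⊗ m = l ⊗ s m`. -/
def BalancedTensor (S L M : Type*) [Ring S] [AddCommGroup L] [Module Sᵐᵒᵖ L] [AddCommGroup M]
    [Module S M] :=
  (L ⊗[ℤ] M) ⧸ AddSubgroup.closure
    {t : L ⊗[ℤ] M | ∃ (l : L) (s : S) (m : M),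
      t = (MulOpposite.op s • l) ⊗ₜ[ℤ] m - l ⊗ₜ[ℤ] (s • m)}

namespace BalancedTensor

variable {S L M : Type*} [Ring S] [AddCommGroup L] [Module Sᵐᵒᵖ L] [AddCommGroup M] [Module S M]

instance : AddCommGroup (BalancedTensor S L M) :=
  inferInstanceAs (AddCommGroup ((L ⊗[ℤ] M) ⧸ AddSubgroup.closure
    {t : L ⊗[ℤ] M | ∃ (l : L) (s : S) (m : M),
      t = (MulOpposite.op s • l) ⊗ₜ[ℤ] m - l ⊗ₜ[ℤ] (s • m)}))

variable (S) in
/-- The element `l ⊗ m`. -/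
def tmul (l : L) (m : M) : BalancedTensor S L M := QuotientAddGroup.mk (l ⊗ₜ[ℤ] m)

theorem hom_ext {A : Type*} [AddCommGroup A] {φ ψ : BalancedTensor S L M →+ A}
    (h : ∀ l m, φ (tmul S l m) = ψ (tmul S l m)) : φ = ψ := by
  refine QuotientAddGroup.addMonoidHom_ext _ ?_
  ext t
  induction t using TensorProduct.induction_on with
  | zero => simp
  | tmul l m => exact h l m
  | add s t hs ht => rw [map_add, map_add, hs, ht]

/-- The endomorphism `φ ⊗ 1`. -/
def mapLeft (φ : Module.End Sᵐᵒᵖ L) : BalancedTensor S L M →+ BalancedTensor S L M :=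
  QuotientAddGroup.map _ _
    (LinearMap.rTensor M φ.toAddMonoidHom.toIntLinearMap).toAddMonoidHom <| by
      rw [AddSubgroup.closure_le]
      rintro _ ⟨l, s, m, rfl⟩
      refine AddSubgroup.subset_closure ⟨φ l, s, m, ?_⟩
      simp

theorem mapLeft_tmul (φ : Module.End Sᵐᵒᵖ L) (l : L) (m : M) :
    mapLeft φ (tmul S l m) = tmul S (φ l) m := rfl

theorem add_tmul (l l' : L) (m : M) : tmul S (l + l') m = tmul S l m + tmul S l' m :=
  congrArg QuotientAddGroup.mk (TensorProduct.add_tmul l l' m)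

theorem zero_tmul (m : M) : tmul S (0 : L) m = 0 :=
  congrArg QuotientAddGroup.mk (TensorProduct.zero_tmul L m)

variable (S L M) in
/-- Endomorphisms of the right module `L` act on `L ⊗_S M` through the first factor. -/
def mapLeftHom : Module.End Sᵐᵒᵖ L →+* AddMonoid.End (BalancedTensor S L M) where
  toFun := mapLeft
  map_one' := hom_ext fun _ _ => rfl
  map_mul' _ _ := hom_ext fun _ _ => rfl
  map_zero' := hom_ext fun _ m => zero_tmul m
  map_add' φ ψ := hom_ext fun l m => add_tmul (φ l) (ψ l) m

end BalancedTensor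

/-! ### Induced modules -/

namespace GroupoidRingSheaf

variable {X : Type u} [Groupoid.{w} X] [TopologicalSpace X] [TopologicalSpace (Quiver.Total X)]
  (O : GroupoidRingSheaf.{u, w, v} X)

/-- The induced module `Ind_x(M) = L_x ⊗_{B_x} M`. -/
abbrev Ind (x : X) (M : Type*) [AddCommGroup M] [Module (O.IsotropyRing x) M] :=
  BalancedTensor (O.IsotropyRing x) (O.IndBimodule x) M

/-- The left `Γ_c(𝒢, 𝒪)`-module structure of `Ind_x(M)`. -/
def indAction [IsAmpleGroupoid X] (x : X) (M : Type*) [AddCommGroup M]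
    [Module (O.IsotropyRing x) M] : O.ConvAlgebra →ₙ+* AddMonoid.End (O.Ind x M) :=
  ((BalancedTensor.mapLeftHom (O.IsotropyRing x) (O.IndBimodule x) M :
    Module.End (O.IsotropyRing x)ᵐᵒᵖ (O.IndBimodule x) →ₙ+* AddMonoid.End (O.Ind x M))).comp
    (O.leftAction x)

end GroupoidRingSheaf

/-! ### Simple modules, primitive ideals, left max rings

A left module over a not necessarily unital ring `R` is an abelian group `M` together with a ring
homomorphism `R →ₙ+* AddMonoid.End M`. -/

/-- The annihilator of a left `R`-module. -/
def moduleAnnihilator {R M : Type*} [NonUnitalRing R] [AddCommGroup M]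
    (ρ : R →ₙ+* AddMonoid.End M) : TwoSidedIdeal R :=
  TwoSidedIdeal.ker ρ

/-- Simple (unitary) left `R`-modules: `M ≠ 0`, `R M = M`, and `M` has no submodules other than
`0` and `M`. -/
structure IsSimpleUnitaryModule {R M : Type*} [NonUnitalRing R] [AddCommGroup M]
    (ρ : R →ₙ+* AddMonoid.End M) : Prop where
  nontrivial : Nontrivial M
  unitary : AddSubgroup.closure {n : M | ∃ (r : R) (m : M), n = ρ r m} = ⊤
  eq_bot_or_eq_top : ∀ N : AddSubgroup M, (∀ (r : R), ∀ m ∈ N, ρ r m ∈ N) → N = ⊥ ∨ N = ⊤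

/-- A (left) primitive ideal: the annihilator of a simple left module.  (A simple module is
isomorphic to a quotient of the additive group of `R`, so the universe of `R` suffices.) -/
def IsLeftPrimitiveIdeal {R : Type u} [NonUnitalRing R] (I : TwoSidedIdeal R) : Prop :=
  ∃ (M : Type u) (_ : AddCommGroup M) (ρ : R →ₙ+* AddMonoid.End M),
    IsSimpleUnitaryModule ρ ∧ I = moduleAnnihilator ρ

/-- A left max ring: every nonzero left module (in the universe `u`) has a maximal proper
submodule. -/
def IsLeftMaxRing (S : Type w) [Ring S] : Prop :=
  ∀ (M : Type u) [AddCommGroup M] [Module S M] [Nontrivial M], ∃ N : Submodule S M, IsCoatom N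

end

open Filter Topology

noncomputable section

namespace GroupoidRingSheaf

variable {X : Type u} [Groupoid.{w} X] [TopologicalSpace X] [TopologicalSpace (Quiver.Total X)]
  {O : GroupoidRingSheaf.{u, w, v} X}

/-! ### Germs of sections -/

/-! A unitary module `M` over the convolution algebra is treated as a sheaf on the unit space. Its
stalk at `y` is `Germ ρ y`, the quotient of `M` by the elements killed by the idempotent of some
compact open neighbourhood of `y`. An algebra element supported on a compact open bisection through
`γ : y ⟶ z`, with value `a` at `γ`, induces a map of stalks from `y` to `z` that depends only on `γ`
and `a` (`transport`). In particular `B_x` acts on the stalk at `x`, and the action of `f`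
disintegrates: the germ of `f m` at `y` is the sum of the transports of germs of `m` along the
arrows ending at `y`, with coefficients the values of `f` (`germ_act`). Since the unit space is
Hausdorff, germs at finitely many points can be prescribed independently, so if `f` annihilates `M`,
then for each pair `z`, `y` the sum over the arrows `z ⟶ y` already vanishes
(`component_eq_zero_of_act_eq_zero`).

Let `M` be simple. Some stalk is nonzero (`exists_nontrivial_germ`), and the max ring hypothesis
gives it a maximal submodule `N`. The elements of `M` whose germs along the orbit of `x` all lie in
`N`, once carried back to `x`, form a proper submodule, which is therefore zero
(`orbitSubgroup_eq_bot`). The condition for `f` to annihilate the module induced from the stalk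
modulo `N` is a family of equations in that quotient (`mem_moduleAnnihilator_indAction`), built from
the same sums as in the disintegration (`transport_component`). Elements annihilating `M` satisfy
these equations; conversely, the equations put every `f m` in the zero submodule above. So the two
annihilators agree (`moduleAnnihilator_eq_indAction`), with no isomorphism between `M` and the
induced module needed.

In the other direction, modules induced from simple modules are themselves simple
(`isSimpleUnitaryModule_indAction`): idempotents isolate one orbit point, bisections move it
anywhere in the orbit, and simplicity over `B_x` does the rest. -/

theorem exists_isOpen_eqOn {f g : O.ArrowSection} {W : Set (Quiver.Total X)} (hW : IsOpen W)
    (hf : ContinuousOn (fun γ => (⟨γ.right, f γ⟩ : EtaleSpace O.stalk)) W)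
    (hg : ContinuousOn (fun γ => (⟨γ.right, g γ⟩ : EtaleSpace O.stalk)) W)
    {γ : Quiver.Total X} (hγ : γ ∈ W) (h : f γ = g γ) :
    ∃ N ⊆ W, IsOpen N ∧ γ ∈ N ∧ ∀ β ∈ N, f β = g β := by
  rw [continuousOn_iff_continuous_domRestrict] at hf hg
  -- Two continuous lifts of the range map through the locally injective projection agree on an open
  -- set; `E` need not be Hausdorff.
  have ho := O.isLocalHomeomorph_base.isLocallyInjective.isOpen_eqLocus (he := rfl) hf hg
  refine ⟨_, ?_, hW.isOpenMap_subtype_val _ ho, ⟨⟨γ, hγ⟩, ?_, rfl⟩, ?_⟩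
  · rintro _ ⟨β, -, rfl⟩
    exact β.2
  · simp [h]
  · rintro _ ⟨β, hβ, rfl⟩
    simpa using hβ

variable (O) in
theorem exists_local_section {y : X} (a : O.stalk y) :
    ∃ V : Set X, IsOpen V ∧ y ∈ V ∧ ∃ σ : ∀ z, O.stalk z, σ y = a ∧
      ContinuousOn (fun z => (⟨z, σ z⟩ : EtaleSpace O.stalk)) V := by
  classical
  obtain ⟨e, he, hp⟩ := O.isLocalHomeomorph_base ⟨y, a⟩
  have hbase : ∀ z ∈ e.target, (e.symm z).base = z := fun z hz => by
    have := e.right_inv hz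
    rwa [← hp] at this
  have hval : ∀ z ∈ e.target, ∃ b : O.stalk z, e.symm z = ⟨z, b⟩ := fun z hz => by
    have h := hbase z hz
    generalize e.symm z = t at h
    obtain ⟨z', b⟩ := t
    cases h
    exact ⟨b, rfl⟩
  have hy : y ∈ e.target := by
    have := e.map_source he
    rwa [← hp] at this
  refine ⟨e.target, e.open_target, hy,
    fun z => if h : z ∈ e.target then (hval z h).choose else 0, ?_, ?_⟩
  · refine (dif_pos hy).trans ?_
    have h1 := (hval y hy).choose_spec
    have h2 := e.left_inv he
    rw [← hp] at h2
    simpa using h1.symm.trans h2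
  · refine e.symm.continuousOn.congr fun z hz => ?_
    exact (congrArg (EtaleSpace.mk z) (dif_pos hz)).trans (hval z hz).choose_spec.symm

variable [IsAmpleGroupoid X]

/-- The filter of arrows whose range is near `y`. -/
def rangeFilter (y : X) : Filter (Quiver.Total X) :=
  comap (fun γ : Quiver.Total X => γ.right) (𝓝 y)

theorem image_range_mem_nhds {N : Set (Quiver.Total X)} (hN : IsOpen N) {γ : Quiver.Total X}
    (hγ : γ ∈ N) : (fun γ : Quiver.Total X => γ.right) '' N ∈ 𝓝 γ.right :=
  (IsEtaleGroupoid.isLocalHomeomorph_range.isOpenMap _ hN).mem_nhds ⟨γ, hγ, rfl⟩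

theorem eventually_rangeFilter_of_isOpen {N : Set (Quiver.Total X)} (hN : IsOpen N)
    {γ : Quiver.Total X} (hγ : γ ∈ N) {P : Quiver.Total X → Prop}
    (h : ∀ β, ∀ β' ∈ N, β'.right = β.right → P β) : ∀ᶠ β in rangeFilter γ.right, P β := by
  filter_upwards [preimage_mem_comap (image_range_mem_nhds hN hγ)] with β hβ
  obtain ⟨β', h1, h2⟩ := hβ
  exact h β β' h1 h2

/-- Agreement spreads from `γ` to a neighbourhood inside both bisections, hence to every arrow with
range near that of `γ`: a bisection contains at most one arrow with a given range, and off both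
bisections the two sections vanish. This is why a germ sees only the value at a single arrow. -/
theorem SupportedOn.eventually_eq {f g : O.ArrowSection} {U V : Set (Quiver.Total X)}
    (hU : IsCompactOpenBisection U) (hV : IsCompactOpenBisection V) (hf : O.SupportedOn f U)
    (hg : O.SupportedOn g V) {γ : Quiver.Total X} (hγU : γ ∈ U) (hγV : γ ∈ V) (h : f γ = g γ) :
    ∀ᶠ β in rangeFilter γ.right, f β = g β := by
  obtain ⟨N, hNW, hN, hγN, hfg⟩ := exists_isOpen_eqOn (hU.isOpen.inter hV.isOpen)
    (hf.1.mono Set.inter_subset_left) (hg.1.mono Set.inter_subset_right) ⟨hγU, hγV⟩ h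
  refine eventually_rangeFilter_of_isOpen hN hγN fun β β' hβ' hr => ?_
  by_cases h1 : β ∈ U
  · rw [← hU.injOn_range (hNW hβ').1 h1 hr]
    exact hfg _ hβ'
  by_cases h2 : β ∈ V
  · rw [← hV.injOn_range (hNW hβ').2 h2 hr]
    exact hfg _ hβ'
  · rw [hf.2 _ h1, hg.2 _ h2]

/-- The sum `f + g` is supported on `U ∪ V`, which need not be a bisection, so
`SupportedOn.eventually_eq` does not apply to it directly. -/
theorem SupportedOn.eventually_add_eq {f g k : O.ArrowSection} {U V W : Set (Quiver.Total X)}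
    (hU : IsCompactOpenBisection U) (hV : IsCompactOpenBisection V)
    (hW : IsCompactOpenBisection W) (hf : O.SupportedOn f U)
    (hg : O.SupportedOn g V) (hk : O.SupportedOn k W) {γ : Quiver.Total X} (hγU : γ ∈ U)
    (hγV : γ ∈ V) (hγW : γ ∈ W) (h : f γ + g γ = k γ) :
    ∀ᶠ β in rangeFilter γ.right, f β + g β = k β := by
  have hs : ContinuousOn (fun γ => (⟨γ.right, (f + g) γ⟩ : EtaleSpace O.stalk))
      (U ∩ V ∩ W) := by
    have h1 : ContinuousOn (fun γ => (⟨γ.right, f γ, g γ⟩ : FiberPair O.stalk)) (U ∩ V ∩ W) := by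
      rw [continuousOn_iff_continuous_domRestrict, continuous_induced_rng]
      exact continuousOn_iff_continuous_domRestrict.1
        ((hf.1.mono fun _ h => h.1.1).prodMk (hg.1.mono fun _ h => h.1.2))
    exact O.continuous_add.comp_continuousOn h1
  obtain ⟨N, hNW, hN, hγN, hfg⟩ := exists_isOpen_eqOn ((hU.isOpen.inter hV.isOpen).inter hW.isOpen)
    hs (hk.1.mono Set.inter_subset_right) ⟨⟨hγU, hγV⟩, hγW⟩ h
  refine eventually_rangeFilter_of_isOpen hN hγN fun β β' hβ' hr => ?_
  by_cases h1 : β ∈ U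
  · rw [← hU.injOn_range (hNW hβ').1.1 h1 hr]
    exact hfg _ hβ'
  by_cases h2 : β ∈ V
  · rw [← hV.injOn_range (hNW hβ').1.2 h2 hr]
    exact hfg _ hβ'
  by_cases h3 : β ∈ W
  · rw [← hW.injOn_range (hNW hβ').2 h3 hr]
    exact hfg _ hβ'
  · rw [hf.2 _ h1, hg.2 _ h2, hk.2 _ h3, add_zero]

theorem SupportedOn.eventually_eq_zero {f : O.ArrowSection} {U : Set (Quiver.Total X)}
    (hU : IsCompactOpenBisection U) (hf : O.SupportedOn f U) {y : X}
    (hy : ∀ γ ∈ U, γ.right ≠ y) : ∀ᶠ β in rangeFilter y, f β = 0 := by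
  have := IsEtaleGroupoid.t2Space (X := X)
  -- The arrow space may fail to be Hausdorff, so closedness is obtained for the image in the unit
  -- space.
  have hK : IsCompact ((fun γ : Quiver.Total X => γ.right) '' U) :=
    hU.isCompact.image IsTopologicalGroupoid.continuous_range
  filter_upwards [preimage_mem_comap (hK.isClosed.isOpen_compl.mem_nhds (x := y)
    (by rintro ⟨γ, h1, h2⟩; exact hy γ h1 h2))] with β hβ
  exact hf.2 _ fun h => hβ ⟨β, h, rfl⟩

/-! ### Local bisections and sections through a given point -/

theorem exists_compactOpens {y : X} {V : Set X} (hV : V ∈ 𝓝 y) :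
    ∃ W : TopologicalSpace.CompactOpens X, y ∈ W ∧ (W : Set X) ⊆ V := by
  obtain ⟨W, ⟨h1, h2⟩, h3, h4⟩ :=
    (IsAmpleGroupoid.isTopologicalBasis_compactOpen (X := X)).mem_nhds_iff.1 hV
  exact ⟨⟨⟨W, h2⟩, h1⟩, h3, h4⟩

theorem isLocalHomeomorph_source : IsLocalHomeomorph (fun γ : Quiver.Total X => γ.left) := by
  let e : Quiver.Total X ≃ₜ Quiver.Total X :=
    { toFun := fun γ => ⟨γ.right, γ.left, Groupoid.inv γ.hom⟩
      invFun := fun γ => ⟨γ.right, γ.left, Groupoid.inv γ.hom⟩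
      left_inv := fun γ => by simp
      right_inv := fun γ => by simp
      continuous_toFun := IsTopologicalGroupoid.continuous_inv
      continuous_invFun := IsTopologicalGroupoid.continuous_inv }
  exact IsEtaleGroupoid.isLocalHomeomorph_range.comp e.isLocalHomeomorph

theorem exists_compactOpenBisection {γ : Quiver.Total X} {N : Set (Quiver.Total X)}
    (hN : N ∈ 𝓝 γ) : ∃ U ⊆ N, IsCompactOpenBisection U ∧ γ ∈ U := by
  obtain ⟨e, he, hr⟩ := (IsEtaleGroupoid.isLocalHomeomorph_range (X := X)) γ
  obtain ⟨e', he', hd⟩ := (isLocalHomeomorph_source (X := X)) γ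
  obtain ⟨N', hN', hN'o, hγN'⟩ := mem_nhds_iff.1 hN
  let e₁ := e.restr (e'.source ∩ N')
  have hs : e₁.source = e.source ∩ (e'.source ∩ N') :=
    e.restr_source' _ (e'.open_source.inter hN'o)
  have hγ : γ ∈ e₁.source := by rw [hs]; exact ⟨he, he', hγN'⟩
  obtain ⟨W, h1, h2⟩ := exists_compactOpens (X := X) (e₁.open_target.mem_nhds (e₁.map_source hγ))
  have hsub : e₁.symm '' W ⊆ e₁.source := by
    rintro _ ⟨y, hy, rfl⟩
    exact e₁.map_target (h2 hy)
  refine ⟨e₁.symm '' W, ?_, ⟨?_, ?_, ?_, ?_⟩, ⟨e₁ γ, h1, e₁.left_inv hγ⟩⟩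
  · exact hsub.trans fun β hβ => by rw [hs] at hβ; exact hN' hβ.2.2
  · exact e₁.symm.isOpen_image_of_subset_source W.isOpen h2
  · exact W.isCompact.image_of_continuousOn (e₁.symm.continuousOn.mono h2)
  · refine Set.InjOn.mono (hsub.trans fun β hβ => ?_) (hd ▸ e'.injOn)
    rw [hs] at hβ
    exact hβ.2.1
  · refine Set.InjOn.mono (hsub.trans fun β hβ => ?_) (hr ▸ e.injOn)
    rw [hs] at hβ
    exact hβ.1

/-- `f` is supported on a compact open bisection containing `γ`, and takes the value `a` at `γ`. -/
def Represents (f : O.ConvAlgebra) {x y : X} (γ : x ⟶ y) (a : O.stalk y) : Prop :=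
  ∃ U, IsCompactOpenBisection U ∧ O.SupportedOn f.1 U ∧ (⟨x, y, γ⟩ : Quiver.Total X) ∈ U ∧
    f.1 ⟨x, y, γ⟩ = a

theorem exists_represents {x y : X} (γ : x ⟶ y) (a : O.stalk y) :
    ∃ f : O.ConvAlgebra, Represents f γ a := by
  classical
  obtain ⟨V, hV, hy, σ, hσ, hc⟩ := O.exists_local_section a
  have hr := IsTopologicalGroupoid.continuous_range (X := X)
  obtain ⟨U, hUV, hU, hγ⟩ := exists_compactOpenBisection (γ := (⟨x, y, γ⟩ : Quiver.Total X))
    ((hV.preimage hr).mem_nhds hy)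
  let f : O.ArrowSection := fun β => if β ∈ U then σ β.right else 0
  have hf : O.SupportedOn f U := by
    refine ⟨?_, fun β hβ => if_neg hβ⟩
    refine (hc.comp hr.continuousOn hUV).congr fun β hβ => ?_
    simp [f, hβ]
  exact ⟨⟨f, AddSubgroup.subset_closure ⟨U, hU, hf⟩⟩, U, hU, hf, hγ, by simp [f, hγ, hσ]⟩

theorem conv_val (f g : O.ConvAlgebra) : (f * g).1 = O.conv f.1 g.1 := rfl

theorem Represents.mul {f g : O.ConvAlgebra} {x y z : X} {γ : x ⟶ y} {β : y ⟶ z} {a : O.stalk y}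
    {b : O.stalk z} (hf : Represents f β b) (hg : Represents g γ a) :
    Represents (f * g) (γ ≫ β) (b * O.act β a) := by
  obtain ⟨U, hU, hfU, hβ, rfl⟩ := hf
  obtain ⟨V, hV, hgV, hγ, rfl⟩ := hg
  refine ⟨_, IsCompactOpenBisection.arrowMul hU hV, hfU.conv hU hgV, ⟨⟨y, β⟩, hβ, ?_⟩, ?_⟩
  · simpa using hγ
  · rw [conv_val, conv_eq_single hU hfU _ ⟨y, β⟩ hβ]
    have : (γ ≫ β) ≫ Groupoid.inv β = γ := by simp
    exact congrArg (fun δ => f.1 ⟨y, z, β⟩ * O.act β (g.1 ⟨x, y, δ⟩)) this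

theorem Represents.eventually_eq {f g : O.ConvAlgebra} {x y : X} {γ : x ⟶ y} {a : O.stalk y}
    (hf : Represents f γ a) (hg : Represents g γ a) :
    ∀ᶠ β in rangeFilter y, f.1 β = g.1 β := by
  obtain ⟨U, hU, hfU, hγU, rfl⟩ := hf
  obtain ⟨V, hV, hgV, hγV, h⟩ := hg
  exact hfU.eventually_eq hU hV hgV hγU hγV h.symm

theorem Represents.eventually_add_eq {f g k : O.ConvAlgebra} {x y : X} {γ : x ⟶ y}
    {a b : O.stalk y} (hf : Represents f γ a) (hg : Represents g γ b)
    (hk : Represents k γ (a + b)) : ∀ᶠ β in rangeFilter y, (f + g).1 β = k.1 β := by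
  obtain ⟨U, hU, hfU, hγU, rfl⟩ := hf
  obtain ⟨V, hV, hgV, hγV, rfl⟩ := hg
  obtain ⟨W, hW, hkW, hγW, h⟩ := hk
  exact hfU.eventually_add_eq hU hV hW hgV hkW hγU hγV hγW h.symm

/-! ### Idempotents supported on units -/

open Classical in
/-- The characteristic function of a compact open set of units. -/
def unitIndicator (W : TopologicalSpace.CompactOpens X) : O.ArrowSection := fun γ =>
  if γ ∈ (fun x : X => (⟨x, x, 𝟙 x⟩ : Quiver.Total X)) '' W then 1 else 0

/-- The unit map is a continuous section of the local homeomorphism `r`, hence itself a local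
homeomorphism and open. -/
theorem isCompactOpenBisection_units (W : TopologicalSpace.CompactOpens X) :
    IsCompactOpenBisection ((fun x : X => (⟨x, x, 𝟙 x⟩ : Quiver.Total X)) '' W) where
  isOpen := by
    have : IsLocalHomeomorph (fun x : X => (⟨x, x, 𝟙 x⟩ : Quiver.Total X)) :=
      IsLocalHomeomorph.of_comp (g := fun γ : Quiver.Total X => γ.right)
        (Homeomorph.refl X).isLocalHomeomorph IsEtaleGroupoid.isLocalHomeomorph_range
        IsTopologicalGroupoid.continuous_unit
    exact this.isOpenMap _ W.isOpen
  isCompact := W.isCompact.image IsTopologicalGroupoid.continuous_unit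
  injOn_source := by
    rintro _ ⟨x, -, rfl⟩ _ ⟨y, -, rfl⟩ (h : x = y)
    rw [h]
  injOn_range := by
    rintro _ ⟨x, -, rfl⟩ _ ⟨y, -, rfl⟩ (h : x = y)
    rw [h]

theorem supportedOn_unitIndicator (W : TopologicalSpace.CompactOpens X) :
    O.SupportedOn (unitIndicator W) ((fun x : X => (⟨x, x, 𝟙 x⟩ : Quiver.Total X)) '' W) := by
  refine ⟨?_, fun γ hγ => if_neg hγ⟩
  refine (O.continuous_one.comp IsTopologicalGroupoid.continuous_range).continuousOn.congr
    fun γ hγ => ?_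
  simp only [unitIndicator, if_pos hγ, Function.comp_apply]

variable (O) in
/-- The idempotent of `Γ_c(𝒢, 𝒪)` attached to a compact open set of units. -/
def unitIdem (W : TopologicalSpace.CompactOpens X) : O.ConvAlgebra :=
  ⟨unitIndicator W, AddSubgroup.subset_closure
    ⟨_, isCompactOpenBisection_units W, supportedOn_unitIndicator W⟩⟩

theorem unitIdem_represents {W : TopologicalSpace.CompactOpens X} {x : X} (hx : x ∈ W) :
    Represents (O.unitIdem W) (𝟙 x) 1 :=
  ⟨_, isCompactOpenBisection_units W, supportedOn_unitIndicator W, ⟨x, hx, rfl⟩,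
    if_pos ⟨x, hx, rfl⟩⟩

theorem unitIdem_mul_of_mem {W : TopologicalSpace.CompactOpens X} (f : O.ConvAlgebra)
    {γ : Quiver.Total X} (h : γ.right ∈ W) : (O.unitIdem W * f).1 γ = f.1 γ := by
  have hm : (⟨γ.right, γ.right, 𝟙 γ.right⟩ : Quiver.Total X) ∈
    (fun x : X => (⟨x, x, 𝟙 x⟩ : Quiver.Total X)) '' W := ⟨_, h, rfl⟩
  refine (conv_eq_single (isCompactOpenBisection_units W) (supportedOn_unitIndicator W) γ
    ⟨γ.right, 𝟙 γ.right⟩ hm).trans ?_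
  have : (O.unitIdem W).1 ⟨γ.right, γ.right, 𝟙 γ.right⟩ = 1 := if_pos hm
  change (O.unitIdem W).1 ⟨γ.right, γ.right, 𝟙 γ.right⟩ * _ = _
  rw [this, one_mul, O.act_unit]
  have h2 : γ.hom ≫ Groupoid.inv (𝟙 γ.right) = γ.hom := by simp
  exact h2.symm ▸ rfl

theorem unitIdem_mul_of_notMem {W : TopologicalSpace.CompactOpens X} (f : O.ConvAlgebra)
    {γ : Quiver.Total X} (h : γ.right ∉ W) : (O.unitIdem W * f).1 γ = 0 := by
  refine finsum_eq_zero_of_forall_eq_zero fun β => ?_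
  have : (O.unitIdem W).1 ⟨β.1, γ.right, β.2⟩ = 0 := by
    refine if_neg ?_
    rintro ⟨x, hx, e⟩
    exact h ((congrArg (fun γ : Quiver.Total X => γ.right) e) ▸ hx)
  simp only
  rw [this, zero_mul]

theorem unitIdem_mul_congr {W : TopologicalSpace.CompactOpens X} {f g : O.ConvAlgebra}
    (h : ∀ γ, γ.right ∈ W → f.1 γ = g.1 γ) : O.unitIdem W * f = O.unitIdem W * g := by
  refine Subtype.ext (funext fun γ => ?_)
  by_cases hγ : γ.right ∈ W
  · rw [unitIdem_mul_of_mem f hγ, unitIdem_mul_of_mem g hγ, h γ hγ]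
  · rw [unitIdem_mul_of_notMem f hγ, unitIdem_mul_of_notMem g hγ]

/-- Turns equality near a range point into an identity in the algebra, which can then be applied to
any module. -/
theorem exists_unitIdem_mul_eq {f g : O.ConvAlgebra} {y : X}
    (h : ∀ᶠ β in rangeFilter y, f.1 β = g.1 β) :
    ∃ W : TopologicalSpace.CompactOpens X, y ∈ W ∧ O.unitIdem W * f = O.unitIdem W * g := by
  obtain ⟨V, hV, hVP⟩ := mem_comap.1 h
  obtain ⟨W, hy, hW⟩ := exists_compactOpens (X := X) hV
  exact ⟨W, hy, unitIdem_mul_congr fun γ hγ => hVP (hW hγ)⟩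

theorem unitIdem_apply_of_right_notMem {W : TopologicalSpace.CompactOpens X} {γ : Quiver.Total X}
    (h : γ.right ∉ W) : (O.unitIdem W).1 γ = 0 :=
  if_neg (by rintro ⟨x, hx, rfl⟩; exact h hx)

theorem unitIdem_mul_eq_self {W : TopologicalSpace.CompactOpens X} {f : O.ConvAlgebra}
    (h : ∀ γ, γ.right ∉ W → f.1 γ = 0) : O.unitIdem W * f = f := by
  refine Subtype.ext (funext fun γ => ?_)
  by_cases hγ : γ.right ∈ W
  · rw [unitIdem_mul_of_mem f hγ]
  · rw [unitIdem_mul_of_notMem f hγ, h γ hγ]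

theorem unitIdem_mul_of_le {V W : TopologicalSpace.CompactOpens X} (h : V ≤ W) :
    O.unitIdem W * O.unitIdem V = O.unitIdem V :=
  unitIdem_mul_eq_self fun _ hγ => unitIdem_apply_of_right_notMem fun h' => hγ (h h')

theorem unitIdem_apply_eq {V W : TopologicalSpace.CompactOpens X} {γ : Quiver.Total X}
    (h : γ.right ∈ V ↔ γ.right ∈ W) : (O.unitIdem V).1 γ = (O.unitIdem W).1 γ := by
  classical
  refine if_congr ?_ rfl rfl
  constructor
  · rintro ⟨x, hx, rfl⟩
    exact ⟨x, h.1 hx, rfl⟩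
  · rintro ⟨x, hx, rfl⟩
    exact ⟨x, h.2 hx, rfl⟩

theorem unitIdem_mul_of_ge {V W : TopologicalSpace.CompactOpens X} (h : V ≤ W) :
    O.unitIdem V * O.unitIdem W = O.unitIdem V := by
  refine Eq.trans (unitIdem_mul_congr (g := O.unitIdem V) fun γ hγ => ?_)
    (unitIdem_mul_of_le le_rfl)
  exact unitIdem_apply_eq ⟨fun _ => hγ, fun _ => h hγ⟩

/-- The ranges of the support of a generator fill a compact open set, and finite unions of such sets
are again compact open; this gives left local units. -/
theorem exists_unitIdem_mul_eq_self (f : O.ConvAlgebra) :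
    ∃ W : TopologicalSpace.CompactOpens X, O.unitIdem W * f = f := by
  suffices h : ∃ W : TopologicalSpace.CompactOpens X, ∀ γ, γ.right ∉ W → f.1 γ = 0 by
    obtain ⟨W, h⟩ := h
    exact ⟨W, unitIdem_mul_eq_self h⟩
  obtain ⟨f, hf⟩ := f
  change ∃ W : TopologicalSpace.CompactOpens X, ∀ γ, γ.right ∉ W → f γ = 0
  induction hf using AddSubgroup.closure_induction with
  | mem f h =>
    obtain ⟨U, hU, hf⟩ := h
    refine ⟨⟨⟨(fun γ : Quiver.Total X => γ.right) '' U, hU.isCompact.image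
      IsTopologicalGroupoid.continuous_range⟩,
      IsEtaleGroupoid.isLocalHomeomorph_range.isOpenMap _ hU.isOpen⟩, fun γ hγ => hf.2 _ ?_⟩
    exact fun h => hγ ⟨γ, h, rfl⟩
  | zero => exact ⟨⊥, fun _ _ => rfl⟩
  | add f g _ _ hf hg =>
    obtain ⟨V, hV⟩ := hf
    obtain ⟨W, hW⟩ := hg
    refine ⟨V ⊔ W, fun γ hγ => ?_⟩
    rw [Pi.add_apply, hV _ fun h => hγ (Or.inl h), hW _ fun h => hγ (Or.inr h), add_zero]
  | neg f _ hf =>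
    obtain ⟨V, hV⟩ := hf
    exact ⟨V, fun γ hγ => by rw [Pi.neg_apply, hV γ hγ, neg_zero]⟩

end GroupoidRingSheaf

/-! ### Maps out of balanced tensor products and bilinearity -/

namespace BalancedTensor

variable {S L M : Type*} [Ring S] [AddCommGroup L] [Module Sᵐᵒᵖ L] [AddCommGroup M] [Module S M]

/-- The universal property of the balanced tensor product. -/
def lift {A : Type*} [AddCommGroup A] (φ : L →+ M →+ A)
    (h : ∀ (l : L) (s : S) (m : M), φ (MulOpposite.op s • l) m = φ l (s • m)) :
    BalancedTensor S L M →+ A :=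
  QuotientAddGroup.lift _ (TensorProduct.liftAddHom φ fun r l m => by simp) <| by
    rw [AddSubgroup.closure_le]
    rintro _ ⟨l, s, m, rfl⟩
    simp [h]

theorem tmul_add (l : L) (m m' : M) : tmul S l (m + m') = tmul S l m + tmul S l m' :=
  congrArg QuotientAddGroup.mk (TensorProduct.tmul_add l m m')

theorem tmul_zero (l : L) : tmul S l (0 : M) = 0 :=
  congrArg QuotientAddGroup.mk (TensorProduct.tmul_zero M l)

theorem op_smul_tmul (s : S) (l : L) (m : M) :
    tmul S (MulOpposite.op s • l) m = tmul S l (s • m) := by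
  refine (QuotientAddGroup.eq_iff_sub_mem).2 (AddSubgroup.subset_closure ⟨l, s, m, rfl⟩)

variable (S L) in
/-- The map `l ↦ l ⊗ m`. -/
def tmulRight (m : M) : L →+ BalancedTensor S L M where
  toFun l := tmul S l m
  map_zero' := zero_tmul m
  map_add' l l' := add_tmul l l' m

variable (S M) in
/-- The map `m ↦ l ⊗ m`. -/
def tmulLeft (l : L) : M →+ BalancedTensor S L M where
  toFun m := tmul S l m
  map_zero' := tmul_zero l
  map_add' := tmul_add l

end BalancedTensor

theorem finsum_eq_finsum_comp {α β A : Type*} [AddCommMonoid A] {i : α → β}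
    (hi : Function.Injective i) {F : β → A} (h : ∀ b, b ∉ Set.range i → F b = 0) :
    ∑ᶠ b, F b = ∑ᶠ a, F (i a) := by
  rw [← finsum_mem_range hi, finsum_mem_def, Set.indicator_eq_self.2]
  exact fun b hb => by_contra fun hc => hb (h b hc)

namespace GroupoidRingSheaf

variable {X : Type u} [Groupoid.{w} X] [TopologicalSpace X] [TopologicalSpace (Quiver.Total X)]
  {O : GroupoidRingSheaf.{u, w, v} X}

/-! ### Coordinates of induced modules -/

open Classical in
/-- For `g : x ⟶ y`, the right `B_x`-linear map `L_x → B_x` which is `a 1_γ ↦ α_{g⁻¹}(a) g⁻¹γ` if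
`r(γ) = y`, and `0` otherwise. -/
def cosetCoeff {x y : X} (g : x ⟶ y) : O.IndBimodule x →+ O.IsotropyRing x :=
  indLift fun γ =>
    -- `γ` and `g` have ranges that are equal only propositionally, so `g` is moved along `h` before
    -- inverting.
    if h : y = γ.1 then
      (SkewMonoidAlgebra.singleAddHom (End.of (γ.2 ≫ Groupoid.inv (g ≫ eqToHom h)))).comp
        (O.act (Groupoid.inv (g ≫ eqToHom h))).toAddMonoidHom
    else 0

theorem cosetCoeff_single_self {x y : X} (g h : x ⟶ y) (a : O.stalk y) :
    cosetCoeff g (indSingle ⟨y, h⟩ a) =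
      SkewMonoidAlgebra.single (End.of (h ≫ Groupoid.inv g)) (O.act (Groupoid.inv g) a) := by
  rw [cosetCoeff, indLift_single, dif_pos rfl]
  have : g ≫ eqToHom rfl = g := by simp
  rw [this]
  rfl

theorem cosetCoeff_single_ne {x y : X} (g : x ⟶ y) {γ : Quiver.Star x} (h : y ≠ γ.1)
    (a : O.stalk γ.1) : cosetCoeff g (indSingle γ a) = 0 := by
  rw [cosetCoeff, indLift_single, dif_neg h]
  rfl

/-- On monomials this is `α_{g⁻¹} α_γ = α_{g⁻¹γ}`. Right linearity is what lets the coefficient map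
descend to the balanced tensor product. -/
theorem cosetCoeff_rightMul {x y : X} (g : x ⟶ y) (c : O.IsotropyRing x) (ξ : O.IndBimodule x) :
    cosetCoeff g (rightMul c ξ) = cosetCoeff g ξ * c := by
  induction c using SkewMonoidAlgebra.induction_on with
  | zero => simp
  | add c c' hc hc' => rw [map_add, AddMonoidHom.add_apply, map_add, hc, hc', mul_add]
  | single δ b =>
    suffices h : (cosetCoeff g).comp (rightMul (SkewMonoidAlgebra.single δ b)) =
        (AddMonoidHom.mulRight (SkewMonoidAlgebra.single δ b)).comp (cosetCoeff g) from
      DFunLike.congr_fun h ξ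
    refine ind_hom_ext fun γ a => ?_
    obtain ⟨z, γ⟩ := γ
    rw [AddMonoidHom.comp_apply, AddMonoidHom.comp_apply, rightMul_single, rightMonomial_single,
      AddMonoidHom.mulRight_apply]
    by_cases h : y = z
    · subst h
      rw [cosetCoeff_single_self, cosetCoeff_single_self, SkewMonoidAlgebra.single_mul_single,
        end_smul_def, map_mul, O.act_mul]
      congr 1
      exact Category.assoc _ _ _
    · rw [cosetCoeff_single_ne g h, cosetCoeff_single_ne g h, zero_mul]

section Induced

variable {x : X} {L : Type*} [AddCommGroup L] [Module (O.IsotropyRing x) L]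

variable (L) in
/-- The coordinate of an element of `Ind_x(L)` along an arrow `g` with source `x`. -/
def indCoeff {y : X} (g : x ⟶ y) : O.Ind x L →+ L :=
  BalancedTensor.lift
    ((smulAddHom (O.IsotropyRing x) L).comp (cosetCoeff g))
    fun ξ c l => by
      simp only [AddMonoidHom.comp_apply, smulAddHom_apply, op_smul_def, MulOpposite.unop_op,
        cosetCoeff_rightMul, mul_smul]

theorem indCoeff_tmul {y : X} (g : x ⟶ y) (ξ : O.IndBimodule x) (l : L) :
    indCoeff L g (BalancedTensor.tmul _ ξ l) = cosetCoeff g ξ • l := rfl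

/-- The quotient map by `T` kills all generators, hence is zero. -/
theorem ind_eq_top {T : AddSubgroup (O.Ind x L)}
    (h : ∀ γ a l, BalancedTensor.tmul _ (indSingle γ a) l ∈ T) : T = ⊤ := by
  have h0 : QuotientAddGroup.mk' T = 0 := by
    refine BalancedTensor.hom_ext fun ξ l => ?_
    have : (QuotientAddGroup.mk' T).comp (BalancedTensor.tmulRight _ _ l) = 0 :=
      ind_hom_ext fun γ a => (QuotientAddGroup.eq_zero_iff _).2 (h γ a l)
    exact DFunLike.congr_fun this ξ
  refine (AddSubgroup.eq_top_iff' T).2 fun t => (QuotientAddGroup.eq_zero_iff t).1 ?_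
  exact DFunLike.congr_fun h0 t

/-- In `L_x` one has `a 1_h = 1_g · (α_{g⁻¹}(a) g⁻¹h)`. Thus one arrow per orbit point suffices to
generate `L_x` over `B_x`. -/
theorem tmul_indSingle {y : X} (g h : x ⟶ y) (a : O.stalk y) (l : L) :
    (BalancedTensor.tmul _ (indSingle ⟨y, h⟩ a) l : O.Ind x L) =
      BalancedTensor.tmul _ (indSingle ⟨y, g⟩ 1)
        (SkewMonoidAlgebra.single (End.of (h ≫ Groupoid.inv g)) (O.act (Groupoid.inv g) a) • l) := by
  rw [← BalancedTensor.op_smul_tmul, op_smul_def, MulOpposite.unop_op, rightMul_single,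
    rightMonomial_single, one_mul, O.act_mul]
  congr 1
  have h1 : Groupoid.inv g ≫ g = 𝟙 y := by simp
  have h2 : (h ≫ Groupoid.inv g) ≫ g = h := by simp
  dsimp only
  rw [h1, O.act_unit]
  exact (indSingle_congr h2 a).symm

/-- A chosen arrow from `x` to a point of its orbit. -/
def orbitArrow (y : {y : X // Nonempty (x ⟶ y)}) : x ⟶ y.1 := Classical.choice y.2

theorem exists_orbit_sum (t : O.Ind x L) : ∃ φ : {y : X // Nonempty (x ⟶ y)} →₀ L,
    t = φ.sum fun y l => BalancedTensor.tmul _ (indSingle ⟨y.1, orbitArrow y⟩ 1) l := by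
  let Ψ : ({y : X // Nonempty (x ⟶ y)} →₀ L) →+ O.Ind x L := Finsupp.liftAddHom
    fun y => BalancedTensor.tmulLeft (O.IsotropyRing x) L (indSingle ⟨y.1, orbitArrow y⟩ 1)
  have h : Ψ.range = ⊤ := by
    refine ind_eq_top fun γ a l => ?_
    let y : {y : X // Nonempty (x ⟶ y)} := ⟨γ.1, ⟨γ.2⟩⟩
    refine ⟨Finsupp.single y (SkewMonoidAlgebra.single (End.of (γ.2 ≫ Groupoid.inv (orbitArrow y)))
      (O.act (Groupoid.inv (orbitArrow y)) a) • l), ?_⟩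
    rw [Finsupp.liftAddHom_apply_single]
    exact (tmul_indSingle (orbitArrow y) γ.2 a l).symm
  obtain ⟨φ, hφ⟩ : t ∈ Ψ.range := h ▸ AddSubgroup.mem_top t
  exact ⟨φ, hφ.symm⟩

theorem indCoeff_single_self {y : X} (g : x ⟶ y) (l : L) :
    indCoeff L g (BalancedTensor.tmul (O.IsotropyRing x) (indSingle ⟨y, g⟩ 1) l) = l := by
  rw [indCoeff_tmul, cosetCoeff_single_self, map_one]
  have : End.of (g ≫ Groupoid.inv g) = 1 := by simp
  rw [this, SkewMonoidAlgebra.single_one_one, one_smul]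

theorem indCoeff_single_ne {y z : X} (g : x ⟶ y) (h : x ⟶ z) (hne : y ≠ z) (a : O.stalk z) (l : L) :
    indCoeff L g (BalancedTensor.tmul _ (indSingle ⟨z, h⟩ a) l) = 0 := by
  rw [indCoeff_tmul, cosetCoeff_single_ne g hne, zero_smul]

/-- The coordinate along the chosen arrow to `y` recovers the coefficient at `y` in
`exists_orbit_sum`. -/
theorem ind_eq_zero {t : O.Ind x L} (h : ∀ (y : X) (g : x ⟶ y), indCoeff L g t = 0) : t = 0 := by
  obtain ⟨φ, rfl⟩ := exists_orbit_sum t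
  refine Finset.sum_eq_zero fun y hy => ?_
  have h1 := h y.1 (orbitArrow y)
  rw [map_finsuppSum, Finsupp.sum_eq_single y, indCoeff_single_self] at h1
  · rw [h1]
    exact BalancedTensor.tmul_zero _
  · intro z _ hz
    exact indCoeff_single_ne _ _ (fun e => hz (Subtype.ext e.symm)) _ _
  · intro _
    rw [BalancedTensor.tmul_zero, map_zero]

end Induced

/-! ### The action on induced modules -/

theorem leftMul_single_eq {x y z : X} {f : O.ConvAlgebra} {U : Set (Quiver.Total X)}
    (hU : IsCompactOpenBisection U) (hf : O.SupportedOn f.1 U) (γ : x ⟶ y) {β : y ⟶ z}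
    (hβ : (⟨y, z, β⟩ : Quiver.Total X) ∈ U) (a : O.stalk y) :
    leftMul f (indSingle ⟨y, γ⟩ a) =
      indSingle (⟨z, γ ≫ β⟩ : Quiver.Star x) (f.1 ⟨y, z, β⟩ * O.act β a) := by
  rw [leftMul_single]
  refine finsum_eq_single _ (⟨z, β⟩ : Quiver.Star y) ?_
  rintro ⟨z', β'⟩ hne
  have : f.1 ⟨y, z', β'⟩ = 0 := hf.2 _ fun h => hne (by
    cases hU.injOn_source h hβ rfl
    rfl)
  simp only
  rw [this, zero_mul, map_zero]

theorem Represents.leftMul_single {x y z : X} {f : O.ConvAlgebra} {β : y ⟶ z} {b : O.stalk z}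
    (hf : Represents f β b) (γ : x ⟶ y) (a : O.stalk y) :
    leftMul f (indSingle ⟨y, γ⟩ a) = indSingle (⟨z, γ ≫ β⟩ : Quiver.Star x) (b * O.act β a) := by
  obtain ⟨U, hU, hfU, hβ, rfl⟩ := hf
  exact leftMul_single_eq hU hfU γ hβ a

variable [IsAmpleGroupoid X]

theorem leftMul_unitIdem_of_mem {W : TopologicalSpace.CompactOpens X} {x y : X} (γ : x ⟶ y)
    (a : O.stalk y) (h : y ∈ W) :
    leftMul (O.unitIdem W) (indSingle ⟨y, γ⟩ a) = indSingle ⟨y, γ⟩ a := by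
  rw [(unitIdem_represents h).leftMul_single, one_mul, O.act_unit]
  exact indSingle_congr (Category.comp_id γ) a

theorem leftMul_unitIdem_of_notMem {W : TopologicalSpace.CompactOpens X} {x y : X} (γ : x ⟶ y)
    (a : O.stalk y) (h : y ∉ W) :
    leftMul (O.unitIdem W) (indSingle ⟨y, γ⟩ a) = 0 := by
  rw [GroupoidRingSheaf.leftMul_single]
  refine finsum_eq_zero_of_forall_eq_zero fun β => ?_
  have : (O.unitIdem W).1 ⟨y, β.1, β.2⟩ = 0 := if_neg <| by
    rintro ⟨z, hz, e⟩
    have e' : z = y := congrArg (fun γ : Quiver.Total X => γ.left) e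
    exact h (e' ▸ hz)
  simp only
  rw [this, zero_mul, map_zero]

variable {x : X} {L : Type*} [AddCommGroup L] [Module (O.IsotropyRing x) L]

theorem indAction_tmul (f : O.ConvAlgebra) (ξ : O.IndBimodule x) (l : L) :
    O.indAction x L f (BalancedTensor.tmul _ ξ l) = BalancedTensor.tmul _ (leftMul f ξ) l := rfl

theorem indCoeff_indAction (f : O.ConvAlgebra) {y z : X} (g : x ⟶ y) (h : x ⟶ z) (l : L) :
    indCoeff L g (O.indAction x L f (BalancedTensor.tmul _ (indSingle ⟨z, h⟩ 1) l)) =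
      ∑ᶠ b : z ⟶ y, (SkewMonoidAlgebra.single (End.of (h ≫ b ≫ Groupoid.inv g))
        (O.act (Groupoid.inv g) (f.1 ⟨z, y, b⟩)) : O.IsotropyRing x) • l := by
  rw [indAction_tmul, leftMul_single]
  have e := ((indCoeff L g).comp (BalancedTensor.tmulRight (O.IsotropyRing x) _ l)).map_finsum
    (leftSingle_finite f (⟨z, h⟩ : Quiver.Star x) 1)
  refine e.trans ((finsum_eq_finsum_comp (i := fun b : z ⟶ y => (⟨y, b⟩ : Quiver.Star z))
    (fun b b' h => by cases h; rfl) ?_).trans (finsum_congr fun b => ?_))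
  · rintro ⟨y', b⟩ hb
    refine indCoeff_single_ne _ _ ?_ _ _
    rintro rfl
    exact hb ⟨b, rfl⟩
  · change indCoeff L g (BalancedTensor.tmul _ (indSingle ⟨y, h ≫ b⟩ _) l) = _
    rw [indCoeff_tmul, cosetCoeff_single_self, map_one, mul_one, Category.assoc]

/-- The sums are the matrix coefficients of `f` relative to the generators `1_h ⊗ l` and the
coordinates along `g`; the generators span and the coordinates separate points. -/
theorem mem_moduleAnnihilator_indAction {f : O.ConvAlgebra} :
    f ∈ moduleAnnihilator (O.indAction x L) ↔
      ∀ (y z : X) (g : x ⟶ y) (h : x ⟶ z) (l : L),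
        ∑ᶠ b : z ⟶ y, (SkewMonoidAlgebra.single (End.of (h ≫ b ≫ Groupoid.inv g))
          (O.act (Groupoid.inv g) (f.1 ⟨z, y, b⟩)) : O.IsotropyRing x) • l = 0 := by
  rw [moduleAnnihilator, TwoSidedIdeal.mem_ker]
  constructor
  · intro hf y z g h l
    rw [← indCoeff_indAction, hf]
    exact map_zero _
  · intro hf
    ext t
    obtain ⟨φ, rfl⟩ := exists_orbit_sum t
    rw [map_finsuppSum]
    refine Finset.sum_eq_zero fun z _ => ind_eq_zero fun y g => ?_
    rw [indCoeff_indAction, hf]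

/-! ### Simplicity of induced modules -/

theorem isSimpleUnitaryModule_indAction [IsSimpleModule (O.IsotropyRing x) L] :
    IsSimpleUnitaryModule (O.indAction x L) where
  nontrivial := by
    have := IsSimpleModule.nontrivial (O.IsotropyRing x) L
    obtain ⟨l, hl⟩ := exists_ne (0 : L)
    refine ⟨⟨BalancedTensor.tmul _ (indSingle ⟨x, 𝟙 x⟩ 1) l, 0, fun h => hl ?_⟩⟩
    rw [← indCoeff_single_self (O := O) (𝟙 x) l, h, map_zero]
  unitary := ind_eq_top fun γ a l => by
    obtain ⟨W, hW, -⟩ := exists_compactOpens (X := X) (y := γ.1) Filter.univ_mem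
    refine AddSubgroup.subset_closure ⟨O.unitIdem W, BalancedTensor.tmul _ (indSingle γ a) l, ?_⟩
    rw [indAction_tmul]
    exact congrArg (fun ξ => BalancedTensor.tmul _ ξ l) (leftMul_unitIdem_of_mem γ.2 a hW).symm
  eq_bot_or_eq_top := by
    intro N hN
    refine or_iff_not_imp_left.2 fun hbot => ?_
    have := IsEtaleGroupoid.t2Space (X := X)
    obtain ⟨t, htN, ht0⟩ := N.bot_or_exists_ne_zero.resolve_left hbot
    obtain ⟨φ, rfl⟩ := exists_orbit_sum t
    obtain ⟨y, hy⟩ : ∃ y, φ y ≠ 0 := by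
      by_contra! hc
      exact ht0 (Finset.sum_eq_zero fun y _ => by
        rw [hc y]
        exact BalancedTensor.tmul_zero _)
    -- `W` contains `y` but none of the finitely many other orbit points occurring in `t`, so its
    -- idempotent cuts `t` down to the single term at `y`.
    obtain ⟨W, hyW, hW⟩ := exists_compactOpens (X := X) (y := y.1)
      (V := (Subtype.val '' ((φ.support : Set _) \ {y}))ᶜ)
      (((φ.support.finite_toSet.subset Set.sdiff_subset).image _).isClosed.isOpen_compl.mem_nhds (by
        rintro ⟨z, hz, e⟩
        exact hz.2 (Subtype.ext e)))
    have h1 : BalancedTensor.tmul _ (indSingle ⟨y.1, orbitArrow y⟩ 1) (φ y) ∈ N := by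
      have := hN (O.unitIdem W) _ htN
      rw [map_finsuppSum, Finsupp.sum_eq_single y, indAction_tmul,
        leftMul_unitIdem_of_mem _ _ hyW] at this
      · exact this
      · intro z hz hzy
        rw [indAction_tmul, leftMul_unitIdem_of_notMem, BalancedTensor.zero_tmul]
        exact fun h => hW h ⟨z, ⟨Finsupp.mem_support_iff.2 hz, hzy⟩, rfl⟩
      · intro _
        rw [BalancedTensor.tmul_zero, map_zero]
    let L' : Submodule (O.IsotropyRing x) L :=
      { carrier := {l | ∀ γ a, BalancedTensor.tmul _ (indSingle γ a) l ∈ N}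
        zero_mem' := fun γ a => by rw [BalancedTensor.tmul_zero]; exact zero_mem N
        add_mem' := fun h h' γ a => by
          rw [BalancedTensor.tmul_add]; exact add_mem (h γ a) (h' γ a)
        smul_mem' := fun c l hl => by
          induction c using SkewMonoidAlgebra.induction_on with
          | zero =>
            intro γ a
            rw [zero_smul, BalancedTensor.tmul_zero]
            exact zero_mem N
          | add c c' hc hc' =>
            intro γ a
            rw [add_smul, BalancedTensor.tmul_add]
            exact add_mem (hc γ a) (hc' γ a)
          | single δ b =>
            intro γ a
            rw [← BalancedTensor.op_smul_tmul, op_smul_def, MulOpposite.unop_op, rightMul_single,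
              rightMonomial_single]
            exact hl _ _ }
    have hmem : φ y ∈ L' := by
      rintro ⟨z, γ⟩ a
      -- The arrow is chosen so that `f` carries `1` at the orbit arrow of `y` to `a` at `γ`.
      obtain ⟨f, hf⟩ := exists_represents (O := O) (Groupoid.inv (orbitArrow y) ≫ γ) a
      have h2 := hN f _ h1
      rw [indAction_tmul, hf.leftMul_single, map_one, mul_one] at h2
      have e : orbitArrow y ≫ Groupoid.inv (orbitArrow y) ≫ γ = γ := by simp
      rwa [indSingle_congr e] at h2
    have htop : L' = ⊤ := (eq_bot_or_eq_top L').resolve_left fun h =>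
      hy ((Submodule.mem_bot _).1 (h ▸ hmem))
    exact ind_eq_top fun γ a l => (htop ▸ Submodule.mem_top : l ∈ L') γ a

end GroupoidRingSheaf

namespace GroupoidRingSheaf

variable {X : Type u} [Groupoid.{w} X] [TopologicalSpace X] [TopologicalSpace (Quiver.Total X)]
  {O : GroupoidRingSheaf.{u, w, v} X}

theorem finite_sources {f : O.ArrowSection} (hf : FiberFinite f) (y : X) :
    {z : X | ∃ b : z ⟶ y, f ⟨z, y, b⟩ ≠ 0}.Finite := by
  refine ((hf.1 y).image fun β => β.1).subset ?_
  rintro z ⟨b, hb⟩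
  exact ⟨⟨z, b⟩, hb, rfl⟩

variable [IsAmpleGroupoid X] {M : Type*} [AddCommGroup M]
  (ρ : O.ConvAlgebra →ₙ+* AddMonoid.End M)

/-! ### Germs of a module -/

variable {ρ} in
theorem mul_act (f g : O.ConvAlgebra) (m : M) : ρ (f * g) m = ρ f (ρ g m) := by
  rw [map_mul]
  rfl

variable {ρ} in
theorem unitIdem_act_eq_zero_of_le {V W : TopologicalSpace.CompactOpens X} (h : V ≤ W) {m : M}
    (hm : ρ (O.unitIdem W) m = 0) : ρ (O.unitIdem V) m = 0 := by
  rw [← unitIdem_mul_of_ge h, mul_act, hm, map_zero]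

/-- The elements of a `Γ_c(𝒢, 𝒪)`-module whose germ at `y` vanishes. -/
def germKer (y : X) : AddSubgroup M where
  carrier := {m | ∃ W : TopologicalSpace.CompactOpens X, y ∈ W ∧ ρ (O.unitIdem W) m = 0}
  zero_mem' := by
    obtain ⟨W, hW, -⟩ := exists_compactOpens (X := X) (y := y) Filter.univ_mem
    exact ⟨W, hW, map_zero _⟩
  add_mem' := by
    rintro m m' ⟨V, hV, hm⟩ ⟨W, hW, hm'⟩
    obtain ⟨U, hU, hUVW⟩ := exists_compactOpens (X := X)
      (Filter.inter_mem (V.isOpen.mem_nhds hV) (W.isOpen.mem_nhds hW))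
    refine ⟨U, hU, ?_⟩
    rw [map_add, unitIdem_act_eq_zero_of_le (fun _ h => (hUVW h).1) hm,
      unitIdem_act_eq_zero_of_le (fun _ h => (hUVW h).2) hm', add_zero]
  neg_mem' := by
    rintro m ⟨W, hW, hm⟩
    exact ⟨W, hW, by rw [map_neg, hm, neg_zero]⟩

/-- The stalk at `y` of a `Γ_c(𝒢, 𝒪)`-module. -/
def Germ (y : X) := M ⧸ germKer ρ y

instance (y : X) : AddCommGroup (Germ ρ y) := inferInstanceAs (AddCommGroup (M ⧸ germKer ρ y))

/-- The germ at `y`. -/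
def germ (y : X) : M →+ Germ ρ y := QuotientAddGroup.mk' (germKer ρ y)

theorem germ_surjective (y : X) : Function.Surjective (germ ρ y) :=
  QuotientAddGroup.mk'_surjective _

theorem germ_eq_zero_iff {y : X} {m : M} : germ ρ y m = 0 ↔
    ∃ W : TopologicalSpace.CompactOpens X, y ∈ W ∧ ρ (O.unitIdem W) m = 0 :=
  QuotientAddGroup.eq_zero_iff m

/-- The germ at `y` of `f m` depends only on the values of `f` at arrows with range near `y`. -/
theorem germ_congr {y : X} {f g : O.ConvAlgebra} (h : ∀ᶠ β in rangeFilter y, f.1 β = g.1 β)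
    (m : M) : germ ρ y (ρ f m) = germ ρ y (ρ g m) := by
  obtain ⟨W, hy, hW⟩ := exists_unitIdem_mul_eq h
  rw [← sub_eq_zero, ← map_sub]
  refine (germ_eq_zero_iff ρ).2 ⟨W, hy, ?_⟩
  rw [map_sub, ← mul_act, ← mul_act, hW, sub_self]

theorem germ_unitIdem {y : X} {W : TopologicalSpace.CompactOpens X} (h : y ∈ W) (m : M) :
    germ ρ y (ρ (O.unitIdem W) m) = germ ρ y m := by
  rw [← sub_eq_zero, ← map_sub]
  refine (germ_eq_zero_iff ρ).2 ⟨W, h, ?_⟩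
  rw [map_sub, ← mul_act, unitIdem_mul_of_le le_rfl, sub_self]

theorem Represents.mul_unitIdem {f : O.ConvAlgebra} {y z : X} {γ : y ⟶ z} {a : O.stalk z}
    (hf : Represents f γ a) {W : TopologicalSpace.CompactOpens X} (h : y ∈ W) :
    Represents (f * O.unitIdem W) γ a := by
  have := hf.mul (unitIdem_represents h)
  rwa [map_one, mul_one, Category.id_comp] at this

/-- The action of `a 1_γ` on germs. -/
def transport {y z : X} (γ : y ⟶ z) (a : O.stalk z) : Germ ρ y →+ Germ ρ z :=
  QuotientAddGroup.lift _ ((germ ρ z).comp (ρ (exists_represents γ a).choose)) <| by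
    rintro m ⟨W, hW, hm⟩
    have hf := (exists_represents γ a).choose_spec
    change germ ρ z (ρ (exists_represents γ a).choose m) = 0
    -- Inserting the idempotent on the right changes neither the arrow nor the value represented,
    -- and it kills `m`.
    rw [germ_congr ρ (hf.eventually_eq (hf.mul_unitIdem hW)), mul_act, hm, map_zero, map_zero]

variable {ρ}

/-- Removes the chosen representative from the definition: any representative computes the
transport. -/
theorem transport_germ {f : O.ConvAlgebra} {y z : X} {γ : y ⟶ z} {a : O.stalk z}
    (hf : Represents f γ a) (m : M) : transport ρ γ a (germ ρ y m) = germ ρ z (ρ f m) :=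
  germ_congr ρ ((exists_represents γ a).choose_spec.eventually_eq hf) m

theorem transport_transport {y z t : X} (γ : y ⟶ z) (β : z ⟶ t) (a : O.stalk z) (b : O.stalk t)
    (μ : Germ ρ y) :
    transport ρ β b (transport ρ γ a μ) = transport ρ (γ ≫ β) (b * O.act β a) μ := by
  obtain ⟨m, rfl⟩ := germ_surjective ρ y μ
  obtain ⟨f, hf⟩ := exists_represents (O := O) β b
  obtain ⟨g, hg⟩ := exists_represents (O := O) γ a
  rw [transport_germ hg, transport_germ hf, transport_germ (hf.mul hg), mul_act]

theorem transport_id {y : X} (μ : Germ ρ y) : transport ρ (𝟙 y) 1 μ = μ := by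
  obtain ⟨m, rfl⟩ := germ_surjective ρ y μ
  obtain ⟨W, hW, -⟩ := exists_compactOpens (X := X) (y := y) Filter.univ_mem
  rw [transport_germ (unitIdem_represents hW), germ_unitIdem ρ hW]

theorem transport_add {y z : X} (γ : y ⟶ z) (a b : O.stalk z) :
    transport ρ γ (a + b) = transport ρ γ a + transport ρ γ b := by
  ext μ
  obtain ⟨m, rfl⟩ := germ_surjective ρ y μ
  obtain ⟨f, hf⟩ := exists_represents (O := O) γ a
  obtain ⟨g, hg⟩ := exists_represents (O := O) γ b
  obtain ⟨k, hk⟩ := exists_represents (O := O) γ (a + b)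
  rw [AddMonoidHom.add_apply, transport_germ hf, transport_germ hg, transport_germ hk,
    ← germ_congr ρ (hf.eventually_add_eq hg hk), map_add]
  exact map_add _ _ _

theorem transport_zero {y z : X} (γ : y ⟶ z) : transport ρ γ (0 : O.stalk z) = 0 := by
  have := transport_add (ρ := ρ) γ 0 0
  rw [add_zero] at this
  exact left_eq_add.1 this

theorem transport_neg {y z : X} (γ : y ⟶ z) (a : O.stalk z) :
    transport ρ γ (-a) = -transport ρ γ a := by
  rw [eq_neg_iff_add_eq_zero, ← transport_add, neg_add_cancel, transport_zero]

variable (ρ) in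
/-- The action of the isotropy skew group ring on germs. -/
def isotropyAct (x : X) : O.IsotropyRing x →+ (Germ ρ x →+ Germ ρ x) where
  toFun c := c.sum fun δ b => transport ρ (End.asHom δ) b
  map_zero' := SkewMonoidAlgebra.sum_zero_index
  map_add' _ _ := SkewMonoidAlgebra.sum_add_index' (fun _ => transport_zero _)
    (fun _ => transport_add _)

theorem isotropyAct_single {x : X} (δ : End x) (b : O.stalk x) :
    isotropyAct ρ x (SkewMonoidAlgebra.single δ b) = transport ρ (End.asHom δ) b :=
  SkewMonoidAlgebra.sum_single_index (transport_zero _)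

theorem isotropyAct_mul {x : X} (c d : O.IsotropyRing x) :
    isotropyAct ρ x (c * d) = (isotropyAct ρ x c).comp (isotropyAct ρ x d) := by
  induction c using SkewMonoidAlgebra.induction_on with
  | zero => simp
  | add c c' hc hc' => rw [add_mul, map_add, map_add, hc, hc', AddMonoidHom.add_comp]
  | single δ b =>
    induction d using SkewMonoidAlgebra.induction_on with
    | zero => simp
    | add d d' hd hd' => rw [mul_add, map_add, map_add, hd, hd', AddMonoidHom.comp_add]
    | single η c =>
      ext μ
      rw [SkewMonoidAlgebra.single_mul_single, AddMonoidHom.comp_apply, isotropyAct_single,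
        isotropyAct_single, isotropyAct_single, transport_transport]
      rfl

instance (x : X) : Module (O.IsotropyRing x) (Germ ρ x) where
  smul c μ := isotropyAct ρ x c μ
  one_smul μ := by
    change isotropyAct ρ x 1 μ = μ
    rw [SkewMonoidAlgebra.one_def, isotropyAct_single]
    exact transport_id μ
  mul_smul c d μ := DFunLike.congr_fun (isotropyAct_mul c d) μ
  smul_zero c := map_zero (isotropyAct ρ x c)
  smul_add c := map_add (isotropyAct ρ x c)
  add_smul c d μ := DFunLike.congr_fun (map_add (isotropyAct ρ x) c d) μ
  zero_smul μ := DFunLike.congr_fun (map_zero (isotropyAct ρ x)) μ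

theorem single_smul_germ {x : X} (δ : x ⟶ x) (b : O.stalk x) (μ : Germ ρ x) :
    (SkewMonoidAlgebra.single (End.of δ) b : O.IsotropyRing x) • μ = transport ρ δ b μ :=
  DFunLike.congr_fun (isotropyAct_single (End.of δ) b) μ

/-! ### Disintegration of the action -/

/-- The part of the action of `f` which maps germs at `z` to germs at `y`. -/
def component (f : O.ArrowSection) {z : X} (y : X) (μ : Germ ρ z) : Germ ρ y :=
  ∑ᶠ b : z ⟶ y, transport ρ b (f ⟨z, y, b⟩) μ

theorem component_finite {f : O.ArrowSection} (hf : FiberFinite f) {y z : X} (μ : Germ ρ z) :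
    (Function.support fun b : z ⟶ y => transport ρ b (f ⟨z, y, b⟩) μ).Finite := by
  refine ((hf.1 y).preimage (f := fun b : z ⟶ y => (⟨z, b⟩ : Quiver.Costar y)) ?_).subset ?_
  · intro b _ b' _ h
    cases h
    rfl
  · intro b hb h0
    refine hb ?_
    simp only at h0 ⊢
    rw [h0, transport_zero, AddMonoidHom.zero_apply]

theorem component_eq_zero {f : O.ArrowSection} {y z : X} (h : ∀ b : z ⟶ y, f ⟨z, y, b⟩ = 0)
    (μ : Germ ρ z) : component f y μ = 0 :=
  finsum_eq_zero_of_forall_eq_zero fun b => by rw [h, transport_zero, AddMonoidHom.zero_apply]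

theorem component_zero_right (f : O.ArrowSection) (y z : X) :
    component f y (0 : Germ ρ z) = 0 :=
  finsum_eq_zero_of_forall_eq_zero fun _ => map_zero _

theorem component_add {f g : O.ArrowSection} (hf : FiberFinite f) (hg : FiberFinite g) {y z : X}
    (μ : Germ ρ z) : component (f + g) y μ = component f y μ + component g y μ := by
  simp only [component, Pi.add_apply, transport_add, AddMonoidHom.add_apply]
  exact finsum_add_distrib (component_finite hf μ) (component_finite hg μ)

theorem component_neg (f : O.ArrowSection) {y z : X} (μ : Germ ρ z) :
    component (-f) y μ = -component f y μ := by
  simp only [component, Pi.neg_apply, transport_neg, AddMonoidHom.neg_apply]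
  exact finsum_neg_distrib _

theorem component_germ_finite {f : O.ArrowSection} (hf : FiberFinite f) (y : X) (m : M) :
    (Function.support fun z : X => component f y (germ ρ z m)).Finite := by
  refine (finite_sources hf y).subset fun z hz => ?_
  by_contra hc
  refine hz (component_eq_zero (fun b => ?_) _)
  by_contra h0
  exact hc ⟨b, h0⟩

/-- Both sides are additive in `f`, so one bisection suffices. If it has an arrow ending at `y`,
that arrow is unique and both sides are the transport along it; otherwise `f` vanishes on all arrows
with range near `y`. -/
theorem germ_act (f : O.ConvAlgebra) (y : X) (m : M) :
    germ ρ y (ρ f m) = ∑ᶠ z : X, component f.1 y (germ ρ z m) := by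
  obtain ⟨f, hf⟩ := f
  change germ ρ y (ρ (⟨f, hf⟩ : O.convAddSubgroup) m) = ∑ᶠ z : X, component f y (germ ρ z m)
  induction hf using AddSubgroup.closure_induction with
  | mem f h =>
    obtain ⟨U, hU, hfU⟩ := h
    by_cases hy : ∃ β : Quiver.Costar y, (⟨β.1, y, β.2⟩ : Quiver.Total X) ∈ U
    · obtain ⟨⟨z, β⟩, hβ⟩ := hy
      have hz : ∀ b : z ⟶ y, b ≠ β → f ⟨z, y, b⟩ = 0 := fun b hb => hfU.2 _ fun h => hb (by
        cases hU.injOn_range h hβ rfl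
        rfl)
      have hz' : ∀ z', z' ≠ z → ∀ b : z' ⟶ y, f ⟨z', y, b⟩ = 0 := fun z' hne b =>
        hfU.2 _ fun h => hne (by
          cases hU.injOn_range h hβ rfl
          rfl)
      rw [finsum_eq_single _ z fun z' hne => component_eq_zero (hz' z' hne) _, component,
        finsum_eq_single _ β fun b hb => by
          rw [hz b hb, transport_zero, AddMonoidHom.zero_apply]]
      exact (transport_germ ⟨U, hU, hfU, hβ, rfl⟩ m).symm
    · have h0 : ∀ᶠ β in rangeFilter y, f β = (0 : O.ConvAlgebra).1 β :=
        hfU.eventually_eq_zero hU fun γ hγ e => hy (by cases e; exact ⟨⟨γ.left, γ.hom⟩, hγ⟩)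
      rw [finsum_eq_zero_of_forall_eq_zero fun z => component_eq_zero (fun b => ?_) _]
      · refine (germ_congr ρ h0 m).trans ?_
        rw [map_zero]
        exact map_zero _
      · exact hfU.2 _ fun h => hy ⟨⟨z, b⟩, h⟩
  | zero =>
    rw [finsum_eq_zero_of_forall_eq_zero fun z => component_eq_zero (fun b => rfl) _]
    change germ ρ y (ρ (0 : O.ConvAlgebra) m) = 0
    rw [map_zero]
    exact map_zero _
  | add f g hf hg ihf ihg =>
    have h1 := fiberFinite_of_mem hf
    have h2 := fiberFinite_of_mem hg
    simp only [component_add h1 h2]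
    rw [finsum_add_distrib (component_germ_finite h1 y m) (component_germ_finite h2 y m),
      ← ihf, ← ihg, ← map_add]
    exact congrArg _ (DFunLike.congr_fun
      (map_add ρ (⟨f, hf⟩ : O.convAddSubgroup) (⟨g, hg⟩ : O.convAddSubgroup)) m)
  | neg f hf ihf =>
    simp only [component_neg]
    rw [finsum_neg_distrib, ← ihf, ← map_neg]
    exact congrArg _ (DFunLike.congr_fun (map_neg ρ (⟨f, hf⟩ : O.convAddSubgroup)) m)

/-- Cut `m` by the idempotent of a compact open neighbourhood of `z` missing the rest of `Z`; that
neighbourhood is closed, so the idempotent vanishes near each other point. -/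
theorem exists_germ_separated {Z : Set X} (hZ : Z.Finite) (z : X) (m : M) :
    ∃ m' : M, germ ρ z m' = germ ρ z m ∧ ∀ z' ∈ Z, z' ≠ z → germ ρ z' m' = 0 := by
  have := IsEtaleGroupoid.t2Space (X := X)
  obtain ⟨W, hz, hW⟩ := exists_compactOpens (X := X) (y := z) (V := (Z \ {z})ᶜ)
    ((hZ.subset Set.sdiff_subset).isClosed.isOpen_compl.mem_nhds fun h => h.2 rfl)
  refine ⟨ρ (O.unitIdem W) m, germ_unitIdem ρ hz m, fun z' hz' hne => ?_⟩
  have hz'W : z' ∈ (W : Set X)ᶜ := fun h => hW h ⟨hz', hne⟩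
  obtain ⟨V, hV, hVW⟩ := exists_compactOpens (X := X)
    (W.isCompact.isClosed.isOpen_compl.mem_nhds hz'W)
  refine (germ_eq_zero_iff ρ).2 ⟨V, hV, ?_⟩
  have : O.unitIdem V * O.unitIdem W = O.unitIdem V * 0 :=
    unitIdem_mul_congr fun γ hγ => unitIdem_apply_of_right_notMem (hVW hγ)
  rw [← mul_act, this, mul_zero, map_zero]
  rfl

/-- Only finitely many sources contribute at `y`, so a separated representative isolates the source
`z` in `germ_act`. Distinct arrows `z ⟶ y` are not separated this way; only their sum vanishes. -/
theorem component_eq_zero_of_act_eq_zero {f : O.ConvAlgebra} (hf : ρ f = 0) (y z : X)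
    (μ : Germ ρ z) : component f.1 y μ = 0 := by
  obtain ⟨m, rfl⟩ := germ_surjective ρ z μ
  obtain ⟨m', hm', h0⟩ := exists_germ_separated (ρ := ρ)
    (finite_sources (fiberFinite_of_mem f.2) y) z m
  have h := germ_act f y m' (ρ := ρ)
  rw [finsum_eq_single _ z, hm', hf] at h
  · exact h.symm.trans (map_zero _)
  · intro z' hne
    by_cases hz' : ∃ b : z' ⟶ y, f.1 ⟨z', y, b⟩ ≠ 0
    · rw [h0 z' hz' hne, component_zero_right]
    · exact component_eq_zero (fun b => by_contra fun hb => hz' ⟨b, hb⟩) _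

/-! ### Elements of a unitary module are determined by their germs -/

theorem unitIdem_sup_act {V W : TopologicalSpace.CompactOpens X} {m : M}
    (hV : ρ (O.unitIdem V) m = 0) (hW : ρ (O.unitIdem W) m = 0) :
    ρ (O.unitIdem (V ⊔ W)) m = 0 := by
  -- Inclusion–exclusion for characteristic functions.
  have h : O.unitIdem (V ⊔ W) =
      O.unitIdem V + (O.unitIdem W - O.unitIdem V * O.unitIdem W) := by
    refine Subtype.ext (funext fun γ => ?_)
    change (O.unitIdem (V ⊔ W)).1 γ =
      (O.unitIdem V).1 γ + ((O.unitIdem W).1 γ - (O.unitIdem V * O.unitIdem W).1 γ)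
    by_cases h1 : γ.right ∈ V
    · rw [unitIdem_mul_of_mem _ h1, sub_self, add_zero]
      exact unitIdem_apply_eq ⟨fun _ => h1, fun _ => Or.inl h1⟩
    · rw [unitIdem_mul_of_notMem _ h1, sub_zero, unitIdem_apply_of_right_notMem h1, zero_add]
      exact unitIdem_apply_eq ⟨fun h => h.resolve_left h1, Or.inr⟩
  rw [h, map_add, map_sub]
  change ρ (O.unitIdem V) m + (ρ (O.unitIdem W) m - ρ (O.unitIdem V * O.unitIdem W) m) = 0
  rw [mul_act, hV, hW, map_zero, sub_self, add_zero]

theorem exists_unitIdem_act_eq_self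
    (hρ : AddSubgroup.closure {n : M | ∃ (r : O.ConvAlgebra) (m : M), n = ρ r m} = ⊤) (m : M) :
    ∃ W : TopologicalSpace.CompactOpens X, ρ (O.unitIdem W) m = m := by
  have hm : m ∈ AddSubgroup.closure {n : M | ∃ (r : O.ConvAlgebra) (m : M), n = ρ r m} :=
    hρ ▸ AddSubgroup.mem_top m
  induction hm using AddSubgroup.closure_induction with
  | mem n h =>
    obtain ⟨f, m, rfl⟩ := h
    obtain ⟨W, hW⟩ := exists_unitIdem_mul_eq_self f
    exact ⟨W, by rw [← mul_act, hW]⟩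
  | zero => exact ⟨⊥, map_zero _⟩
  | add m n _ _ hm hn =>
    obtain ⟨V, hV⟩ := hm
    obtain ⟨W, hW⟩ := hn
    refine ⟨V ⊔ W, ?_⟩
    rw [map_add]
    nth_rw 1 [← hV]
    nth_rw 1 [← hW]
    rw [← mul_act, ← mul_act, unitIdem_mul_of_le le_sup_left, unitIdem_mul_of_le le_sup_right,
      hV, hW]
  | neg m _ hm =>
    obtain ⟨V, hV⟩ := hm
    exact ⟨V, by rw [map_neg, hV]⟩

/-- Unitarity gives a compact open `W` whose idempotent fixes `m`; compactness then merges the local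
vanishing neighbourhoods into one `V` containing `W`. -/
theorem eq_zero_of_germ_eq_zero
    (hρ : AddSubgroup.closure {n : M | ∃ (r : O.ConvAlgebra) (m : M), n = ρ r m} = ⊤) {m : M}
    (h : ∀ y, germ ρ y m = 0) : m = 0 := by
  obtain ⟨W, hW⟩ := exists_unitIdem_act_eq_self hρ m
  obtain ⟨V, hWV, hV⟩ : ∃ V : TopologicalSpace.CompactOpens X,
      (W : Set X) ⊆ V ∧ ρ (O.unitIdem V) m = 0 := by
    refine W.isCompact.induction_on
      (p := fun s => ∃ V : TopologicalSpace.CompactOpens X, s ⊆ V ∧ ρ (O.unitIdem V) m = 0) ?_ ?_ ?_ ?_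
    · have h0 : O.unitIdem (⊥ : TopologicalSpace.CompactOpens X) = 0 := by
        rw [← unitIdem_mul_of_le (le_refl (⊥ : TopologicalSpace.CompactOpens X)),
          unitIdem_mul_congr (W := ⊥) (g := 0) (fun _ hγ => False.elim hγ), mul_zero]
      exact ⟨⊥, Set.empty_subset _, by
        rw [h0, map_zero]
        rfl⟩
    · rintro s t hst ⟨V, h1, h2⟩
      exact ⟨V, hst.trans h1, h2⟩
    · rintro s t ⟨V, h1, h2⟩ ⟨V', h1', h2'⟩
      exact ⟨V ⊔ V', Set.union_subset_union h1 h1', unitIdem_sup_act h2 h2'⟩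
    · intro y _
      obtain ⟨V, hy, hV⟩ := (germ_eq_zero_iff ρ).1 (h y)
      exact ⟨V, mem_nhdsWithin_of_mem_nhds (V.isOpen.mem_nhds hy), V, subset_rfl, hV⟩
  rw [← hW]
  exact unitIdem_act_eq_zero_of_le hWV hV

end GroupoidRingSheaf

namespace GroupoidRingSheaf

variable {X : Type u} [Groupoid.{w} X] [TopologicalSpace X] [TopologicalSpace (Quiver.Total X)]
  [IsAmpleGroupoid X] {O : GroupoidRingSheaf.{u, w, v} X} {M : Type*} [AddCommGroup M]
  {ρ : O.ConvAlgebra →ₙ+* AddMonoid.End M}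

/-! ### Simple modules and quotients of their stalks -/

/-- Carrying both ends back to `x` turns a component of `f` into the `B_x`-expression that describes
induced modules. -/
theorem transport_component (f : O.ConvAlgebra) {x y z : X} (g : x ⟶ y) (h : x ⟶ z)
    (μ : Germ ρ x) :
    transport ρ (Groupoid.inv g) 1 (component f.1 y (transport ρ h 1 μ)) =
      ∑ᶠ b : z ⟶ y, (SkewMonoidAlgebra.single (End.of (h ≫ b ≫ Groupoid.inv g))
        (O.act (Groupoid.inv g) (f.1 ⟨z, y, b⟩)) : O.IsotropyRing x) • μ := by
  rw [component, AddMonoidHom.map_finsum _ (component_finite (fiberFinite_of_mem f.2) _)]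
  refine finsum_congr fun b => ?_
  rw [single_smul_germ, transport_transport, transport_transport, map_one, mul_one, one_mul]

theorem transport_inv_transport {x y : X} (g : x ⟶ y) (μ : Germ ρ y) :
    transport ρ g 1 (transport ρ (Groupoid.inv g) 1 μ) = μ := by
  rw [transport_transport, map_one, mul_one, Groupoid.inv_comp, transport_id]

theorem transport_germ_act_mem {f : O.ConvAlgebra} {m : M} {x : X}
    (N : Submodule (O.IsotropyRing x) (Germ ρ x)) {y : X} (g : x ⟶ y)
    (hN : ∀ (z : X) (h : x ⟶ z), ∑ᶠ b : z ⟶ y,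
      (SkewMonoidAlgebra.single (End.of (h ≫ b ≫ Groupoid.inv g))
        (O.act (Groupoid.inv g) (f.1 ⟨z, y, b⟩)) : O.IsotropyRing x) •
          transport ρ (Groupoid.inv h) 1 (germ ρ z m) ∈ N) :
    transport ρ (Groupoid.inv g) 1 (germ ρ y (ρ f m)) ∈ N := by
  rw [germ_act, AddMonoidHom.map_finsum _ (component_germ_finite (fiberFinite_of_mem f.2) y m)]
  refine finsum_induction (p := (· ∈ N)) (zero_mem N) (fun _ _ => add_mem) fun z => ?_
  obtain hz | ⟨⟨b⟩⟩ := isEmpty_or_nonempty (z ⟶ y)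
  · rw [component, finsum_of_isEmpty, map_zero]
    exact zero_mem N
  -- Only sources `z` with an arrow `b` to `y` contribute, and these lie in the orbit of `x` through
  -- `b⁻¹g`.
  · have := hN z (g ≫ Groupoid.inv b)
    rwa [← transport_component, transport_inv_transport] at this

/-- The elements of a module all of whose germs along the orbit of `x` lie in `N`. -/
def orbitSubgroup {x : X} (N : Submodule (O.IsotropyRing x) (Germ ρ x)) : AddSubgroup M where
  carrier := {m | ∀ (y : X) (g : x ⟶ y), transport ρ (Groupoid.inv g) 1 (germ ρ y m) ∈ N}
  zero_mem' y g := by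
    rw [map_zero, map_zero]
    exact zero_mem N
  add_mem' hm hn y g := by
    rw [map_add, map_add]
    exact add_mem (hm y g) (hn y g)
  neg_mem' hm y g := by
    rw [map_neg, map_neg]
    exact neg_mem (hm y g)

theorem finsum_smul_mem {x y z : X} (N : Submodule (O.IsotropyRing x) (Germ ρ x))
    (c : (z ⟶ y) → O.IsotropyRing x) {μ : Germ ρ x} (hμ : μ ∈ N) : ∑ᶠ b, c b • μ ∈ N :=
  finsum_induction (p := (· ∈ N)) (zero_mem N) (fun _ _ => add_mem) fun _ => N.smul_mem _ hμ

/-- The subgroup is stable under the algebra. Were it all of `M`, its condition at the unit arrow of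
`x` would force every germ at `x` into `N`. -/
theorem orbitSubgroup_eq_bot (hρ : IsSimpleUnitaryModule ρ) {x : X}
    {N : Submodule (O.IsotropyRing x) (Germ ρ x)} (hN : N ≠ ⊤) : orbitSubgroup N = ⊥ := by
  refine (hρ.eq_bot_or_eq_top (orbitSubgroup N) ?_).resolve_right fun htop => hN ?_
  · exact fun f m hm y g => transport_germ_act_mem N g fun z h => finsum_smul_mem N _ (hm z h)
  · refine Submodule.eq_top_iff'.2 fun μ => ?_
    obtain ⟨m, rfl⟩ := germ_surjective ρ x μ
    have hm : m ∈ orbitSubgroup N := htop ▸ AddSubgroup.mem_top m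
    have h := hm x (𝟙 x)
    have e : Groupoid.inv (𝟙 x) = 𝟙 x := by simp
    rwa [e, transport_id] at h

theorem finsum_smul_mkQ (f : O.ConvAlgebra) {x y z : X} (g : x ⟶ y) (h : x ⟶ z)
    (N : Submodule (O.IsotropyRing x) (Germ ρ x)) (μ : Germ ρ x) :
    ∑ᶠ b : z ⟶ y, (SkewMonoidAlgebra.single (End.of (h ≫ b ≫ Groupoid.inv g))
        (O.act (Groupoid.inv g) (f.1 ⟨z, y, b⟩)) : O.IsotropyRing x) • N.mkQ μ =
      N.mkQ (∑ᶠ b : z ⟶ y, (SkewMonoidAlgebra.single (End.of (h ≫ b ≫ Groupoid.inv g))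
        (O.act (Groupoid.inv g) (f.1 ⟨z, y, b⟩)) : O.IsotropyRing x) • μ) := by
  simp only [← map_smul]
  refine (N.mkQ.toAddMonoidHom.map_finsum ?_).symm
  -- Each summand is the image under transport along `g⁻¹` of a summand of the component, so
  -- finiteness of the support carries over.
  have := (component_finite (fiberFinite_of_mem f.2) (y := y) (transport ρ h 1 μ))
  refine this.subset fun b hb h0 => hb ?_
  simp only at h0 ⊢
  have e := congrArg (transport ρ (Groupoid.inv g) 1) h0
  rw [map_zero, transport_transport, transport_transport, map_one, mul_one, one_mul] at e
  rw [single_smul_germ, e]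

/-- Modulo `N`, the equations for the induced module say that `f` sends every `m` into
`orbitSubgroup N`, which is zero. For this, `N` need only be proper. -/
theorem moduleAnnihilator_eq_indAction (hρ : IsSimpleUnitaryModule ρ) {x : X}
    {N : Submodule (O.IsotropyRing x) (Germ ρ x)} (hN : N ≠ ⊤) :
    moduleAnnihilator ρ = moduleAnnihilator (O.indAction x (Germ ρ x ⧸ N)) := by
  ext f
  rw [mem_moduleAnnihilator_indAction]
  constructor
  · intro hf y z g h l
    obtain ⟨μ, rfl⟩ := N.mkQ_surjective l
    rw [finsum_smul_mkQ, ← transport_component,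
      component_eq_zero_of_act_eq_zero ((TwoSidedIdeal.mem_ker ρ).1 hf), map_zero, map_zero]
  · intro hf
    refine (TwoSidedIdeal.mem_ker ρ).2 (AddMonoidHom.ext fun m => ?_)
    have : ρ f m ∈ orbitSubgroup N := fun y g => transport_germ_act_mem N g fun z h => by
      have := hf y z g h (N.mkQ (transport ρ (Groupoid.inv h) 1 (germ ρ z m)))
      rwa [finsum_smul_mkQ, Submodule.mkQ_apply, Submodule.Quotient.mk_eq_zero] at this
    rw [orbitSubgroup_eq_bot hρ hN] at this
    exact this

theorem exists_nontrivial_germ (hρ : IsSimpleUnitaryModule ρ) : ∃ x, Nontrivial (Germ ρ x) := by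
  by_contra! hc
  obtain ⟨m, hm⟩ := @exists_ne M hρ.nontrivial 0
  exact hm (eq_zero_of_germ_eq_zero hρ.unitary fun y => Subsingleton.elim _ _)

end GroupoidRingSheaf

end

open GroupoidRingSheaf in
/-- The primitive ideals of `Γ_c(𝒢, 𝒪)` are exactly the annihilators of the modules induced from
simple modules over the isotropy skew group rings, provided these are left max rings. -/
theorem theoremt {X : Type u} [Groupoid.{w} X] [TopologicalSpace X]
    [TopologicalSpace (Quiver.Total X)] [IsAmpleGroupoid X]
    (O : GroupoidRingSheaf.{u, w, v} X)
    (hmax : ∀ x : X, IsLeftMaxRing.{max u w v} (O.IsotropyRing x)) :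
    {I : TwoSidedIdeal O.ConvAlgebra | IsLeftPrimitiveIdeal I} =
      {I : TwoSidedIdeal O.ConvAlgebra |
        ∃ (x : X) (M : Type (max u w v)) (_ : AddCommGroup M) (_ : Module (O.IsotropyRing x) M),
          IsSimpleModule (O.IsotropyRing x) M ∧ I = moduleAnnihilator (O.indAction x M)} := by
  ext I
  constructor
  · rintro ⟨M, _, ρ, hρ, rfl⟩
    obtain ⟨x, hx⟩ := exists_nontrivial_germ hρ
    obtain ⟨N, hN⟩ := hmax x (Germ ρ x)
    -- Maximality of `N` serves only to make the quotient simple; the equality of annihilators uses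
    -- `hN.1`.
    exact ⟨x, Germ ρ x ⧸ N, inferInstance, inferInstance, isSimpleModule_iff_isCoatom.2 hN,
      moduleAnnihilator_eq_indAction hρ hN.1⟩
  · rintro ⟨x, M, _, _, hM, rfl⟩
    exact ⟨O.Ind x M, inferInstance, O.indAction x M, isSimpleUnitaryModule_indAction, rfl⟩
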